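/- **Conventions.** Thompson's group $F$ consists of the orientation-preserving piecewise linear self-homeomorphisms of $[0,1]$ with finitely many breakpoints, all of them dyadic rationals, and all slopes integral powers of $2$. Every $g\in F$ has a reduced pair $(T_1,T_2)$ of planar rooted binary trees with the same number of leaves ($g$ maps the $i$-th interval of the standard dyadic partition of $T_1$ affinely onto the $i$-th interval of that of $T_2$, and no two consecutive leaves form a caret in both trees). The height of a tree is the maximal distance from a leaf to the root, and $\mathrm{height}(g)$ is the larger of the heights of $T_1$ and $T_2$. An $(m,n)$-strand diagram is, up to isotopy, a planar graph in the square with vertically monotone edges, $m$ endpoints on the top side, $n$ on the bottom side, and interior vertices that are splits (one edge above, two below) or merges (two above, one below). A reduction cancels a split directly above a merge that shares both edges with it (type I) or a merge directly above a split that shares one edge with it (type II); a diagram is reduced if no reduction applies. $\Gamma^*$ is the vertical reflection, $\Gamma_2\circ\Gamma_1$ is $\Gamma_2$ stacked below $\Gamma_1$, and $\Gamma_2*\Gamma_1$ is the reduced diagram obtained from $\Gamma_2\circ\Gamma_1$. Put $\delta(g)=T_2^*\circ T_1$, let $S_k$ be the symmetric tree with $2^k$ leaves (a $(1,2^k)$-strand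 diagram), and let $\Theta_k(g)=S_k*\delta(g)*S_k^*$, a reduced $(2^k,2^k)$-strand diagram. For an $(m,n)$-strand diagram $\Gamma$, the $(2m,2n)$-tangle $T(\Gamma)$ is obtained by adding, in each complementary region other than the leftmost and the rightmost one, a vertically monotone edge from its top (a split, or the top side of the square) to its bottom (a merge, or the bottom side), by replacing each resulting $4$-valent vertex by a crossing of the arc through its left and right edges with the strand through its other two edges (at all splits and merges the former arc passes over; or, for the other convention, at all of them it passes under), and by adding a trivial strand on the left. **Theorem.** Let $g,h\in F$ with $g\neq h$, and let $m=\max(\mathrm{height}(g),\mathrm{height}(h))$. Then for every integer $k\ge m$ the $(2^{k+1},2^{k+1})$-tangles $T(\Theta_k(g))$ and $T(\Theta_k(h))$ are not isotopic rel endpoints. This holds for either of the two crossing conventions. -/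

import Mathlib

namespace Thompson

/-! ### Thompson's group `F` and reduced pairs of trees -/

/-- A real number of the form `a / 2 ^ b`. -/
def IsDyadic (x : ℝ) : Prop := ∃ (a : ℤ) (b : ℕ), x = a / 2 ^ b

/-- `g` is an orientation-preserving piecewise linear self-homeomorphism of `[0,1]` with finitely
many breakpoints, all of them dyadic (they lie in the finite set `B`), and such that the slope on
every interval without interior breakpoints is an integral power of `2`. -/
def IsThompson (g : unitInterval ≃ₜ unitInterval) : Prop :=
  StrictMono g ∧ ∃ B : Finset ℝ, (∀ b ∈ B, IsDyadic b) ∧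
    ∀ s t : unitInterval, s ≤ t → (∀ b ∈ B, ¬((s : ℝ) < b ∧ b < (t : ℝ))) →
      ∃ k : ℤ, ∀ x : unitInterval, s ≤ x → x ≤ t →
        (g x : ℝ) = (g s : ℝ) + (2 : ℝ) ^ k * ((x : ℝ) - (s : ℝ))

/-- The elements of Thompson's group `F`. -/
abbrev ThompsonF : Type := {g : unitInterval ≃ₜ unitInterval // IsThompson g}

/-- Planar rooted binary trees (`nil` is the tree consisting of a single leaf). Mathlib's
`BinaryTree.height` is the maximal distance from the root to a leaf. -/
abbrev PTree : Type := BinaryTree Unit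

/-- The standard dyadic partition given by a tree whose root is the interval
`[c / 2 ^ n, (c + 1) / 2 ^ n]`: the list of its leaves from left to right, where a pair `(c, n)`
encodes the interval `[c / 2 ^ n, (c + 1) / 2 ^ n]`. -/
def leafIntervals : PTree → ℕ → ℕ → List (ℕ × ℕ)
  | .nil, c, n => [(c, n)]
  | .node _ l r, c, n => leafIntervals l (2 * c) (n + 1) ++ leafIntervals r (2 * c + 1) (n + 1)

/-- `g` maps `[c / 2 ^ n, (c + 1) / 2 ^ n]` affinely and increasingly onto
`[d / 2 ^ m, (d + 1) / 2 ^ m]`, where `I = (c, n)` and `J = (d, m)`. -/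
def MapsAffinely (g : unitInterval ≃ₜ unitInterval) (I J : ℕ × ℕ) : Prop :=
  ∀ x : unitInterval, (I.1 : ℝ) / 2 ^ I.2 ≤ x → (x : ℝ) ≤ ((I.1 : ℝ) + 1) / 2 ^ I.2 →
    (2 : ℝ) ^ J.2 * (g x : ℝ) - J.1 = (2 : ℝ) ^ I.2 * (x : ℝ) - I.1

/-- The pair of trees `(T₁, T₂)` represents `g`: it sends the `i`-th interval of the partition
of `T₁` affinely onto the `i`-th interval of the partition of `T₂`. -/
def Represents (g : unitInterval ≃ₜ unitInterval) (T₁ T₂ : PTree) : Prop :=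
  List.Forall₂ (MapsAffinely g) (leafIntervals T₁ 0 0) (leafIntervals T₂ 0 0)

/-- The leaves number `i` and `i + 1` (counted from the left, starting at `0`) of the tree are the
two children of one vertex, i.e. they form a caret. -/
def HasCaret : PTree → ℕ → Prop
  | .nil, _ => False
  | .node _ l r, i => (l = .nil ∧ r = .nil ∧ i = 0) ∨ HasCaret l i ∨
      (l.numLeaves ≤ i ∧ HasCaret r (i - l.numLeaves))

/-- `(T₁, T₂)` is a reduced pair of trees for `g`: it represents `g` and has no cancelling caret. -/
def IsReducedPair (g : unitInterval ≃ₜ unitInterval) (T₁ T₂ : PTree) : Prop :=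
  Represents g T₁ T₂ ∧ ∀ i, ¬(HasCaret T₁ i ∧ HasCaret T₂ i)

theorem length_leafIntervals (T : PTree) (c n : ℕ) :
    (leafIntervals T c n).length = T.numLeaves := by
  induction T generalizing c n with
  | nil => simp [leafIntervals]
  | node _ l r hl hr => simp [leafIntervals, hl, hr]

theorem Represents.numLeaves_eq {g : unitInterval ≃ₜ unitInterval} {T₁ T₂ : PTree}
    (h : Represents g T₁ T₂) : T₁.numLeaves = T₂.numLeaves := by
  have := h.length_eq
  rwa [length_leafIntervals, length_leafIntervals] at this

/-- Consecutive standard dyadic intervals tiling `[a, b]`. -/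
def Tiles : ℝ → List (ℕ × ℕ) → ℝ → Prop
  | a, [], b => a = b
  | a, I :: L, b => a = (I.1 : ℝ) / 2 ^ I.2 ∧ Tiles (((I.1 : ℝ) + 1) / 2 ^ I.2) L b

theorem Tiles.le {L : List (ℕ × ℕ)} {a b : ℝ} (h : Tiles a L b) : a ≤ b := by
  induction L generalizing a with
  | nil => exact le_of_eq h
  | cons I L ih =>
    obtain ⟨h1, h2⟩ := h
    refine le_trans ?_ (ih h2)
    rw [h1]
    gcongr
    linarith

theorem Tiles.eq_nil {L : List (ℕ × ℕ)} {a : ℝ} (h : Tiles a L a) : L = [] := by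
  cases L with
  | nil => rfl
  | cons I L =>
    exfalso
    obtain ⟨h1, h2⟩ := h
    have h3 := h2.le
    rw [h1] at h3
    have : (0 : ℝ) < 2 ^ I.2 := by positivity
    rw [div_le_div_iff_of_pos_right this] at h3
    linarith

theorem Tiles.split {L : List (ℕ × ℕ)} {a b q : ℝ} (h : Tiles a L b) (haq : a ≤ q) (hqb : q ≤ b) :
    (∃ L₁ L₂, L = L₁ ++ L₂ ∧ Tiles a L₁ q ∧ Tiles q L₂ b) ∨
    ∃ L₁ I L₂, L = L₁ ++ I :: L₂ ∧ Tiles a L₁ ((I.1 : ℝ) / 2 ^ I.2) ∧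
      Tiles (((I.1 : ℝ) + 1) / 2 ^ I.2) L₂ b ∧ (I.1 : ℝ) / 2 ^ I.2 < q ∧
      q < ((I.1 : ℝ) + 1) / 2 ^ I.2 := by
  induction L generalizing a with
  | nil =>
    left
    have : a = b := h
    have h' : a = q := le_antisymm haq (this ▸ hqb)
    exact ⟨[], [], rfl, h', by rw [← h']; exact h⟩
  | cons I L ih =>
    obtain ⟨h1, h2⟩ := h
    rcases eq_or_lt_of_le haq with h3 | h3
    · left
      exact ⟨[], I :: L, rfl, h3, by rw [← h3]; exact ⟨h1, h2⟩⟩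
    rcases lt_or_ge q (((I.1 : ℝ) + 1) / 2 ^ I.2) with h4 | h4
    · right
      exact ⟨[], I, L, rfl, h1, h2, h1 ▸ h3, h4⟩
    · rcases ih h2 h4 with ⟨L₁, L₂, e, t1, t2⟩ | ⟨L₁, J, L₂, e, t1, t2, t3, t4⟩
      · left
        exact ⟨I :: L₁, L₂, by simp [e], ⟨h1, t1⟩, t2⟩
      · right
        exact ⟨I :: L₁, J, L₂, by simp [e], ⟨h1, t1⟩, t2, t3, t4⟩

theorem Tiles.length_pos {L : List (ℕ × ℕ)} {a b : ℝ} (h : Tiles a L b) (hab : a < b) :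
    0 < L.length := by
  cases L with
  | nil => exact absurd h hab.ne
  | cons I L => simp

/-- Every standard dyadic partition comes from a tree. -/
theorem exists_tree_of_tiles (k : ℕ) (L : List (ℕ × ℕ)) (hk : L.length ≤ k) (c n : ℕ)
    (h : Tiles ((c : ℝ) / 2 ^ n) L (((c : ℝ) + 1) / 2 ^ n)) : ∃ T, leafIntervals T c n = L := by
  induction k generalizing L c n with
  | zero =>
    exfalso
    have := h.length_pos (by gcongr; linarith)
    omega
  | succ k ih =>
    have e1 : ((2 * c : ℕ) : ℝ) / 2 ^ (n + 1) = (c : ℝ) / 2 ^ n := by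
      push_cast; field_simp; ring
    have e2 : (((2 * c + 1 : ℕ) : ℝ) + 1) / 2 ^ (n + 1) = ((c : ℝ) + 1) / 2 ^ n := by
      push_cast; field_simp; ring
    have e3 : (((2 * c : ℕ) : ℝ) + 1) / 2 ^ (n + 1) = ((2 * c + 1 : ℕ) : ℝ) / 2 ^ (n + 1) := by
      push_cast; rfl
    have l1 : (c : ℝ) / 2 ^ n < ((2 * c + 1 : ℕ) : ℝ) / 2 ^ (n + 1) := by
      rw [← e1]; gcongr; simp
    have l2 : ((2 * c + 1 : ℕ) : ℝ) / 2 ^ (n + 1) < ((c : ℝ) + 1) / 2 ^ n := by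
      rw [← e2]; gcongr; linarith
    rcases h.split l1.le l2.le with ⟨L₁, L₂, e, t1, t2⟩ | ⟨L₁, I, L₂, e, t1, t2, t3, t4⟩
    · have p1 := t1.length_pos l1
      have p2 := t2.length_pos l2
      have p3 : L.length = L₁.length + L₂.length := by rw [e]; simp
      obtain ⟨T₁, h1⟩ := ih L₁ (by omega) (2 * c) (n + 1) (by rw [e1, e3]; exact t1)
      obtain ⟨T₂, h2⟩ := ih L₂ (by omega) (2 * c + 1) (n + 1) (by rw [e2]; exact t2)
      exact ⟨.node () T₁ T₂, by simp [leafIntervals, h1, h2, e]⟩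
    · obtain ⟨d, m⟩ := I
      simp only at t1 t2 t3 t4
      have hmn : m ≤ n := by
        by_contra hlt
        obtain ⟨j, rfl⟩ : ∃ j, m = n + 1 + j := ⟨m - (n + 1), by omega⟩
        rw [div_lt_div_iff₀ (by positivity) (by positivity), pow_add (2 : ℝ) (n + 1) j] at t3 t4
        have hp : (0 : ℝ) < 2 ^ (n + 1) := by positivity
        have t3' : (d : ℝ) < ((2 * c + 1 : ℕ) : ℝ) * 2 ^ j := by
          refine lt_of_mul_lt_mul_right ?_ hp.le
          linarith
        have t4' : ((2 * c + 1 : ℕ) : ℝ) * 2 ^ j < (d : ℝ) + 1 := by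
          refine lt_of_mul_lt_mul_right ?_ hp.le
          linarith
        have t3'' : d < (2 * c + 1) * 2 ^ j := by exact_mod_cast t3'
        have t4'' : (2 * c + 1) * 2 ^ j < d + 1 := by exact_mod_cast t4'
        omega
      have b1 := t1.le
      have b2 := t2.le
      have hlen : (1 : ℝ) / 2 ^ m ≤ 1 / 2 ^ n := by
        rw [add_div] at b2
        rw [add_div] at b2
        linarith
      have hnm : n ≤ m := by
        rw [one_div_le_one_div (by positivity) (by positivity)] at hlen
        exact (pow_le_pow_iff_right₀ (by norm_num)).1 hlen
      obtain rfl : m = n := le_antisymm hmn hnm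
      have hp : (0 : ℝ) < 2 ^ m := by positivity
      rw [div_le_div_iff_of_pos_right hp] at b1 b2
      have hdc : d = c := by
        have u1 : c ≤ d := by exact_mod_cast b1
        have u2 : d + 1 ≤ c + 1 := by exact_mod_cast b2
        omega
      subst hdc
      have v1 := t1.eq_nil
      have v2 := t2.eq_nil
      exact ⟨.nil, by simp [leafIntervals, e, v1, v2]⟩

/-- Two sibling leaves that form a caret can be replaced by one leaf. -/
theorem HasCaret.collapse {T : PTree} {i : ℕ} (h : HasCaret T i) :
    ∃ T' : PTree, T'.numLeaves < T.numLeaves ∧ ∀ c n, ∃ A a p B,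
      leafIntervals T c n = A ++ ((2 * a, p + 1) :: (2 * a + 1, p + 1) :: B) ∧
      leafIntervals T' c n = A ++ ((a, p) :: B) ∧ A.length = i := by
  induction T generalizing i with
  | nil => exact h.elim
  | node _ l r hl hr =>
    rcases h with ⟨rfl, rfl, rfl⟩ | h | ⟨h1, h2⟩
    · exact ⟨.nil, by simp, fun c n => ⟨[], c, n, [], by simp [leafIntervals]⟩⟩
    · obtain ⟨T', hlt, hT'⟩ := hl h
      refine ⟨.node () T' r, by simpa using hlt, fun c n => ?_⟩
      obtain ⟨A, a, p, B, e1, e2, e3⟩ := hT' (2 * c) (n + 1)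
      exact ⟨A, a, p, B ++ leafIntervals r (2 * c + 1) (n + 1), by simp [leafIntervals, e1],
        by simp [leafIntervals, e2], e3⟩
    · obtain ⟨T', hlt, hT'⟩ := hr h2
      refine ⟨.node () l T', by simpa using hlt, fun c n => ?_⟩
      obtain ⟨A, a, p, B, e1, e2, e3⟩ := hT' (2 * c + 1) (n + 1)
      exact ⟨leafIntervals l (2 * c) (n + 1) ++ A, a, p, B, by simp [leafIntervals, e1],
        by simp [leafIntervals, e2], by simp [length_leafIntervals, e3]; omega⟩

theorem forall₂_append_inv {α β : Type*} {R : α → β → Prop} {A A' : List α} {B B' : List β}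
    (hl : A.length = B.length) (h : List.Forall₂ R (A ++ A') (B ++ B')) :
    List.Forall₂ R A B ∧ List.Forall₂ R A' B' := by
  induction A generalizing B with
  | nil =>
    cases B with
    | nil => exact ⟨.nil, h⟩
    | cons b B => simp at hl
  | cons a A ih =>
    cases B with
    | nil => simp at hl
    | cons b B =>
      simp only [List.cons_append, List.forall₂_cons] at h ⊢
      obtain ⟨h1, h2⟩ := ih (by simpa using hl) h.2
      exact ⟨⟨h.1, h1⟩, h2⟩

theorem forall₂_append' {α β : Type*} {R : α → β → Prop} {A A' : List α} {B B' : List β}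
    (h : List.Forall₂ R A B) (h' : List.Forall₂ R A' B') :
    List.Forall₂ R (A ++ A') (B ++ B') := by
  induction h with
  | nil => exact h'
  | cons h1 _ ih => exact .cons h1 ih

theorem MapsAffinely.join {g : unitInterval ≃ₜ unitInterval} {a p b q : ℕ}
    (h1 : MapsAffinely g (2 * a, p + 1) (2 * b, q + 1))
    (h2 : MapsAffinely g (2 * a + 1, p + 1) (2 * b + 1, q + 1)) :
    MapsAffinely g (a, p) (b, q) := by
  intro x hx1 hx2
  have e1 : ((2 * a : ℕ) : ℝ) / 2 ^ (p + 1) = (a : ℝ) / 2 ^ p := by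
    push_cast; field_simp; ring
  have e2 : (((2 * a + 1 : ℕ) : ℝ) + 1) / 2 ^ (p + 1) = ((a : ℝ) + 1) / 2 ^ p := by
    push_cast; field_simp; ring
  simp only at hx1 hx2 ⊢
  rcases le_total (x : ℝ) (((2 * a : ℕ) + 1 : ℝ) / 2 ^ (p + 1)) with h | h
  · have := h1 x (by simp only [e1]; exact hx1) h
    simp only [pow_succ] at this
    push_cast at this
    linarith
  · have := h2 x (by push_cast at h ⊢; exact h) (by simp only [e2]; exact hx2)
    simp only [pow_succ] at this
    push_cast at this
    linarith

theorem exists_reducedPair_of_represents {g : unitInterval ≃ₜ unitInterval} (k : ℕ)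
    {T₁ T₂ : PTree} (hk : T₁.numLeaves ≤ k) (h : Represents g T₁ T₂) :
    ∃ U₁ U₂, IsReducedPair g U₁ U₂ := by
  induction k generalizing T₁ T₂ with
  | zero =>
    rw [BinaryTree.numLeaves_eq_numNodes_succ] at hk
    omega
  | succ k ih =>
    by_cases hr : ∀ i, ¬(HasCaret T₁ i ∧ HasCaret T₂ i)
    · exact ⟨T₁, T₂, h, hr⟩
    push Not at hr
    obtain ⟨i, h1, h2⟩ := hr
    obtain ⟨T₁', lt1, H1⟩ := h1.collapse
    obtain ⟨T₂', lt2, H2⟩ := h2.collapse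
    obtain ⟨A, a, p, B, e1, e2, e3⟩ := H1 0 0
    obtain ⟨A', a', p', B', e1', e2', e3'⟩ := H2 0 0
    refine ih (T₁ := T₁') (T₂ := T₂') (by omega) ?_
    unfold Represents at h ⊢
    rw [e1, e1'] at h
    obtain ⟨hA, hB⟩ := forall₂_append_inv (e3.trans e3'.symm) h
    simp only [List.forall₂_cons] at hB
    rw [e2, e2']
    exact forall₂_append' hA (.cons (hB.1.join hB.2.1) hB.2.2)

/-- The symmetric tree with `2 ^ k` leaves. -/
def symTree : ℕ → PTree
  | 0 => .nil
  | k + 1 => .node () (symTree k) (symTree k)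

theorem numLeaves_symTree (k : ℕ) : (symTree k).numLeaves = 2 ^ k := by
  induction k with
  | zero => simp [symTree]
  | succ k ih => simp [symTree, ih, pow_succ]; ring

theorem Tiles.append {L L' : List (ℕ × ℕ)} {a b c : ℝ} (h : Tiles a L b) (h' : Tiles b L' c) :
    Tiles a (L ++ L') c := by
  induction L generalizing a with
  | nil =>
    have : a = b := h
    rw [this]
    exact h'
  | cons I L ih => exact ⟨h.1, ih h.2⟩

theorem tiles_leafIntervals (T : PTree) (c n : ℕ) :
    Tiles ((c : ℝ) / 2 ^ n) (leafIntervals T c n) (((c : ℝ) + 1) / 2 ^ n) := by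
  induction T generalizing c n with
  | nil => exact ⟨rfl, rfl⟩
  | node _ l r hl hr =>
    have h1 := hl (2 * c) (n + 1)
    have h2 := hr (2 * c + 1) (n + 1)
    have e1 : ((2 * c : ℕ) : ℝ) / 2 ^ (n + 1) = (c : ℝ) / 2 ^ n := by
      push_cast; field_simp; ring
    have e2 : (((2 * c + 1 : ℕ) : ℝ) + 1) / 2 ^ (n + 1) = ((c : ℝ) + 1) / 2 ^ n := by
      push_cast; field_simp; ring
    have e3 : (((2 * c : ℕ) : ℝ) + 1) / 2 ^ (n + 1) = ((2 * c + 1 : ℕ) : ℝ) / 2 ^ (n + 1) := by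
      push_cast; rfl
    rw [e1, e3] at h1
    rw [e2] at h2
    exact h1.append h2

theorem mem_leafIntervals_symTree {k c n : ℕ} {I : ℕ × ℕ}
    (h : I ∈ leafIntervals (symTree k) c n) : I.2 = n + k ∧ I.1 < (c + 1) * 2 ^ k := by
  induction k generalizing c n with
  | zero => simp [symTree, leafIntervals] at h; simp [h]
  | succ k ih =>
    simp only [symTree, leafIntervals, List.mem_append] at h
    rcases h with h | h
    · obtain ⟨h1, h2⟩ := ih h
      refine ⟨by omega, h2.trans_le ?_⟩
      rw [pow_succ]
      nlinarith [Nat.zero_le (2 ^ k)]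
    · obtain ⟨h1, h2⟩ := ih h
      refine ⟨by omega, h2.trans_le ?_⟩
      rw [pow_succ]
      nlinarith [Nat.zero_le (2 ^ k)]

theorem exists_common_denominator (B : Finset ℝ) (hB : ∀ b ∈ B, IsDyadic b) :
    ∃ N : ℕ, ∀ b ∈ B, ∃ j : ℤ, b = j / 2 ^ N := by
  classical
  induction B using Finset.induction_on with
  | empty => exact ⟨0, by simp⟩
  | insert b B _ ih =>
    obtain ⟨N, hN⟩ := ih fun b hb => hB b (Finset.mem_insert_of_mem hb)
    obtain ⟨a, n, hb⟩ := hB b (Finset.mem_insert_self _ _)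
    refine ⟨N + n, fun b' hb' => ?_⟩
    rcases Finset.mem_insert.1 hb' with rfl | hb'
    · refine ⟨a * 2 ^ N, ?_⟩
      rw [hb]; push_cast; rw [pow_add]; field_simp
    · obtain ⟨j, hj⟩ := hN b' hb'
      refine ⟨j * 2 ^ n, ?_⟩
      rw [hj]; push_cast; rw [pow_add]; field_simp

theorem map_zero_of_strictMono {g : unitInterval ≃ₜ unitInterval} (h : StrictMono g) :
    g 0 = 0 := by
  obtain ⟨x, hx⟩ := g.surjective 0
  have h1 : g 0 ≤ g x := h.monotone unitInterval.nonneg'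
  rw [hx] at h1
  exact le_antisymm h1 unitInterval.nonneg'

theorem map_one_of_strictMono {g : unitInterval ≃ₜ unitInterval} (h : StrictMono g) :
    g 1 = 1 := by
  obtain ⟨x, hx⟩ := g.surjective 1
  have h1 : g x ≤ g 1 := h.monotone unitInterval.le_one'
  rw [hx] at h1
  exact le_antisymm unitInterval.le_one' h1

theorem exists_affine_subdivision {g : unitInterval ≃ₜ unitInterval} (hg : IsThompson g) :
    ∃ N : ℕ, ∀ e < 2 ^ N, ∃ J, MapsAffinely g (e, N) J := by
  obtain ⟨hmono, B, hB, hlin⟩ := hg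
  obtain ⟨N, hN⟩ := exists_common_denominator B hB
  have hmem : ∀ c : ℕ, c ≤ 2 ^ N → (c : ℝ) / 2 ^ N ∈ unitInterval := by
    intro c hc
    refine ⟨by positivity, ?_⟩
    rw [div_le_one (by positivity)]
    exact_mod_cast hc
  have hpiece : ∀ c : ℕ, ∀ hc : c < 2 ^ N, ∃ k : ℤ, ∀ x : unitInterval,
      (c : ℝ) / 2 ^ N ≤ x → (x : ℝ) ≤ ((c : ℝ) + 1) / 2 ^ N →
      (g x : ℝ) = (g ⟨_, hmem c hc.le⟩ : ℝ) + (2 : ℝ) ^ k * ((x : ℝ) - (c : ℝ) / 2 ^ N) := by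
    intro c hc
    obtain ⟨k, hk⟩ := hlin ⟨_, hmem c hc.le⟩ ⟨_, hmem (c + 1) hc⟩
      (Subtype.mk_le_mk.2 (by push_cast; gcongr; linarith)) (by
        rintro b hb ⟨h1, h2⟩
        obtain ⟨j, rfl⟩ := hN b hb
        have hp : (0 : ℝ) < 2 ^ N := by positivity
        simp only at h1 h2
        rw [div_lt_div_iff_of_pos_right hp] at h1 h2
        have u1 : (c : ℤ) < j := by exact_mod_cast h1
        have u2 : j < (c : ℤ) + 1 := by exact_mod_cast h2
        omega)
    refine ⟨k, fun x h1 h2 => hk x (Subtype.coe_le_coe.1 h1) (Subtype.coe_le_coe.1 ?_)⟩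
    push_cast
    exact h2
  have hdy : ∀ c : ℕ, ∀ hc : c ≤ 2 ^ N, ∃ p q : ℕ,
      (g ⟨_, hmem c hc⟩ : ℝ) = (p : ℝ) / 2 ^ q := by
    intro c
    induction c with
    | zero =>
      intro hc
      refine ⟨0, 0, ?_⟩
      have : (⟨_, hmem 0 hc⟩ : unitInterval) = 0 := by ext; simp
      rw [this, map_zero_of_strictMono hmono]
      simp
    | succ c ih =>
      intro hc
      obtain ⟨p, q, h⟩ := ih (by omega)
      obtain ⟨k, hk⟩ := hpiece c (by omega)
      have h2 := hk ⟨_, hmem (c + 1) hc⟩ (by push_cast; gcongr; linarith) (by push_cast; rfl)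
      rw [h2, h]
      have e : (((c + 1 : ℕ) : ℝ) / 2 ^ N - (c : ℝ) / 2 ^ N) = 1 / 2 ^ N := by
        push_cast; ring
      simp only [e]
      rcases Int.eq_nat_or_neg k with ⟨u, rfl | rfl⟩
      · refine ⟨p * 2 ^ N + 2 ^ u * 2 ^ q, q + N, ?_⟩
        rw [zpow_natCast]; push_cast; rw [pow_add]; field_simp
      · refine ⟨p * 2 ^ N * 2 ^ u + 2 ^ q, q + N + u, ?_⟩
        rw [zpow_neg, zpow_natCast]; push_cast; rw [pow_add, pow_add]; field_simp
  have hloc : ∀ c < 2 ^ N, ∃ M₀ : ℕ, ∀ M ≥ M₀, ∀ i < 2 ^ M, ∃ J,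
      MapsAffinely g (c * 2 ^ M + i, N + M) J := by
    intro c hc
    obtain ⟨p, q, hpq⟩ := hdy c hc.le
    obtain ⟨k, hk⟩ := hpiece c hc
    refine ⟨(q + k - N).toNat, fun M hM i hi => ?_⟩
    obtain ⟨r, hr⟩ : ∃ r : ℕ, ((q + r : ℕ) : ℤ) + k = ((N + M : ℕ) : ℤ) :=
      ⟨(N + M - k - q).toNat, by omega⟩
    refine ⟨(p * 2 ^ r + i, q + r), fun x h1 h2 => ?_⟩
    simp only at h1 h2 ⊢
    have hp : (0 : ℝ) < 2 ^ M := by positivity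
    have hi' : (i : ℝ) + 1 ≤ 2 ^ M := by exact_mod_cast hi
    have g1 : (c : ℝ) / 2 ^ N ≤ x := by
      refine le_trans ?_ h1
      rw [div_le_div_iff₀ (by positivity) (by positivity), pow_add]
      push_cast
      have : (0 : ℝ) ≤ i * 2 ^ N := by positivity
      linarith
    have g2 : (x : ℝ) ≤ ((c : ℝ) + 1) / 2 ^ N := by
      refine le_trans h2 ?_
      rw [div_le_div_iff₀ (by positivity) (by positivity), pow_add]
      push_cast
      have : ((i : ℝ) + 1) * 2 ^ N ≤ 2 ^ M * 2 ^ N := by gcongr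
      linarith
    rw [hk x g1 g2, hpq]
    have hz : (2 : ℝ) ^ (q + r) * (2 : ℝ) ^ k = 2 ^ N * 2 ^ M := by
      rw [← pow_add, ← zpow_natCast, ← zpow_natCast, ← hr, zpow_add₀ (by norm_num)]
    rw [mul_add, ← mul_assoc, hz, pow_add, pow_add]
    push_cast
    field_simp
    ring
  choose! M₀ hM₀ using hloc
  refine ⟨N + (Finset.range (2 ^ N)).sup M₀, fun e he => ?_⟩
  set M := (Finset.range (2 ^ N)).sup M₀ with hM
  have hpos : 0 < 2 ^ M := by positivity
  have hc : e / 2 ^ M < 2 ^ N := by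
    rw [Nat.div_lt_iff_lt_mul hpos, ← pow_add]
    exact he
  have := hM₀ (e / 2 ^ M) hc M (Finset.le_sup (f := M₀) (Finset.mem_range.2 hc)) (e % 2 ^ M)
    (Nat.mod_lt _ hpos)
  rwa [mul_comm, Nat.div_add_mod] at this

theorem Tiles.map {g : unitInterval ≃ₜ unitInterval} {L L' : List (ℕ × ℕ)}
    (hR : List.Forall₂ (MapsAffinely g) L L') (a b : unitInterval) (h : Tiles a L b) :
    Tiles (g a) L' (g b) := by
  induction hR generalizing a with
  | nil =>
    have : (a : ℝ) = b := h
    rw [Subtype.coe_injective this]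
    rfl
  | @cons I J L L' hIJ _ ih =>
    obtain ⟨h1, h2⟩ := h
    have hb := h2.le
    have hp : (0 : ℝ) < 2 ^ I.2 := by positivity
    have hq : (0 : ℝ) < 2 ^ J.2 := by positivity
    have hlt : (I.1 : ℝ) / 2 ^ I.2 ≤ ((I.1 : ℝ) + 1) / 2 ^ I.2 := by gcongr; linarith
    have k1 := hIJ a h1.ge (h1 ▸ hlt)
    have hm : ((I.1 : ℝ) + 1) / 2 ^ I.2 ∈ unitInterval := ⟨by positivity, hb.trans b.2.2⟩
    have k2 := hIJ ⟨_, hm⟩ hlt le_rfl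
    refine ⟨?_, ?_⟩
    · rw [h1] at k1
      rw [eq_div_iff hq.ne']
      field_simp at k1
      linarith
    · have : (g ⟨_, hm⟩ : ℝ) = ((J.1 : ℝ) + 1) / 2 ^ J.2 := by
        rw [eq_div_iff hq.ne']
        field_simp at k2
        linarith
      rw [← this]
      exact ih ⟨_, hm⟩ h2

/-- Every element of `F` is represented by a reduced pair of trees. -/
theorem exists_reducedPair (g : ThompsonF) : ∃ T : PTree × PTree, IsReducedPair g.1 T.1 T.2 := by
  obtain ⟨g, hg⟩ := g
  obtain ⟨N, hN⟩ := exists_affine_subdivision hg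
  have h1 : ∀ I ∈ leafIntervals (symTree N) 0 0, ∃ J, MapsAffinely g I J := by
    rintro ⟨e, m⟩ hI
    obtain ⟨h2, h3⟩ := mem_leafIntervals_symTree hI
    simp only [zero_add, one_mul] at h2 h3
    subst h2
    exact hN e h3
  choose! f hf using h1
  have hF : List.Forall₂ (MapsAffinely g) (leafIntervals (symTree N) 0 0)
      ((leafIntervals (symTree N) 0 0).map f) := by
    rw [List.forall₂_map_right_iff, List.forall₂_same]
    exact hf
  have ht : Tiles ((0 : unitInterval) : ℝ) (leafIntervals (symTree N) 0 0)
      ((1 : unitInterval) : ℝ) := by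
    have := tiles_leafIntervals (symTree N) 0 0
    simpa using this
  have ht' := Tiles.map hF 0 1 ht
  rw [map_zero_of_strictMono hg.1, map_one_of_strictMono hg.1] at ht'
  obtain ⟨T, hT⟩ := exists_tree_of_tiles _ _ le_rfl 0 0 (by simpa using ht')
  obtain ⟨U₁, U₂, hU⟩ := exists_reducedPair_of_represents _ (T₁ := symTree N) (T₂ := T) le_rfl
    (by unfold Represents; rw [hT]; exact hF)
  exact ⟨(U₁, U₂), hU⟩

/-- The reduced pair of trees `(T₁, T₂)` of an element of `F`; `T₁` describes the partition of the
domain and `T₂` the partition of the target. -/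
noncomputable def treePair (g : ThompsonF) : PTree × PTree := (exists_reducedPair g).choose

theorem treePair_spec (g : ThompsonF) : IsReducedPair g.1 (treePair g).1 (treePair g).2 :=
  (exists_reducedPair g).choose_spec

/-- The height of an element of `F`: the larger of the heights of the two trees in its reduced
pair of trees. -/
noncomputable def height (g : ThompsonF) : ℕ :=
  max (treePair g).1.height (treePair g).2.height

/-! ### Strand diagrams

An `(m, n)`-strand diagram is a planar graph in the square, all of whose edges are monotone in the
vertical direction, with `m` endpoints on the top side, `n` endpoints on the bottom side, and
interior vertices that are splits (one edge from above, two edges below) or merges (two edges from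
above, one edge below). After an isotopy its vertices lie at different heights; it is then recorded
by the list of its vertices, read from top to bottom, where each vertex is given together with the
number of strands to its left at its height. Two such lists describe isotopic strand diagrams
exactly when they differ by exchanging the heights of consecutive vertices that are not joined by
an edge. -/

/-- The two kinds of interior vertices. -/
inductive Kind
  | split
  | merge

/-- The number of edges entering a vertex from above. -/
def Kind.ins : Kind → ℕ
  | .split => 1
  | .merge => 2

/-- The number of edges leaving a vertex below. -/
def Kind.outs : Kind → ℕ
  | .split => 2
  | .merge => 1

/-- Vertical reflection exchanges splits and merges. -/
def Kind.flip : Kind → Kind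
  | .split => .merge
  | .merge => .split

/-- A vertex together with the number `pos` of strands to its left. -/
structure Vertex where
  kind : Kind
  pos : ℕ

/-- The list `w` of vertices, read from top to bottom, starts with `m` strands at the top and ends
with `n` strands at the bottom, and each vertex is attached to strands that are present. -/
def Fits : ℕ → List Vertex → ℕ → Prop
  | m, [], n => m = n
  | m, v :: w, n => v.pos + v.kind.ins ≤ m ∧ Fits (m - v.kind.ins + v.kind.outs) w n

/-- `(m, n)`-strand diagrams with vertices at different heights. -/
structure StrandDiagram (m n : ℕ) where
  verts : List Vertex
  fits : Fits m verts n

theorem Fits.append {w w' : List Vertex} {m k n : ℕ} (h : Fits m w k) (h' : Fits k w' n) :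
    Fits m (w ++ w') n := by
  induction w generalizing m with
  | nil =>
    have : m = k := h
    rw [this]
    exact h'
  | cons v w ih => exact ⟨h.1, ih h.2⟩

theorem Fits.of_append {w w' : List Vertex} {m n : ℕ} (h : Fits m (w ++ w') n) :
    ∃ k, Fits m w k ∧ Fits k w' n := by
  induction w generalizing m with
  | nil => exact ⟨m, rfl, h⟩
  | cons v w ih =>
    obtain ⟨k, h1, h2⟩ := ih h.2
    exact ⟨k, ⟨h.1, h1⟩, h2⟩

theorem Fits.reflect {w : List Vertex} {m n : ℕ} (h : Fits m w n) :
    Fits n (w.reverse.map fun v => ⟨v.kind.flip, v.pos⟩) m := by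
  induction w generalizing m with
  | nil => exact Eq.symm h
  | cons v w ih =>
    rw [List.reverse_cons, List.map_append]
    refine (ih h.2).append ?_
    obtain ⟨kd, p⟩ := v
    have h1 := h.1
    cases kd <;> simp_all [Fits, Kind.flip, Kind.ins, Kind.outs] <;> omega

/-- Vertical stacking `Γ₂ ∘ Γ₁`: the diagram `Γ₂` is placed below `Γ₁`. -/
def StrandDiagram.comp {m k n : ℕ} (Γ₂ : StrandDiagram k n) (Γ₁ : StrandDiagram m k) :
    StrandDiagram m n :=
  ⟨Γ₁.verts ++ Γ₂.verts, Γ₁.fits.append Γ₂.fits⟩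

/-- The vertical reflection `Γ*`. -/
def StrandDiagram.reflect {m n : ℕ} (Γ : StrandDiagram m n) : StrandDiagram n m :=
  ⟨Γ.verts.reverse.map fun v => ⟨v.kind.flip, v.pos⟩, Γ.fits.reflect⟩

/-- Exchange of heights of two consecutive vertices `X` and `Y` not joined by an edge, where `Y`
lies to the right of `X` with `d` strands in between. -/
def Exchange {m n : ℕ} (Γ Γ' : StrandDiagram m n) : Prop :=
  ∃ (w w' : List Vertex) (X : Vertex) (Y : Kind) (d : ℕ),
    Γ.verts = w ++ (X :: ⟨Y, X.pos + X.kind.outs + d⟩ :: w') ∧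
    Γ'.verts = w ++ (⟨Y, X.pos + X.kind.ins + d⟩ :: X :: w')

/-- Isotopy of strand diagrams. -/
def StrandDiagram.Isotopic {m n : ℕ} : StrandDiagram m n → StrandDiagram m n → Prop :=
  Relation.EqvGen Exchange

/-- A type I cancellation (a split directly above a merge sharing both edges with it) or a type II
cancellation (a merge directly above a split sharing one edge with it). -/
def Cancel {m n : ℕ} (Γ Γ' : StrandDiagram m n) : Prop :=
  ∃ (w w' : List Vertex) (j : ℕ),
    (Γ.verts = w ++ (⟨.split, j⟩ :: ⟨.merge, j⟩ :: w') ∨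
      Γ.verts = w ++ (⟨.merge, j⟩ :: ⟨.split, j⟩ :: w')) ∧
    Γ'.verts = w ++ w'

/-- One reduction move, up to isotopy. -/
def Reduces {m n : ℕ} (Γ Γ' : StrandDiagram m n) : Prop :=
  ∃ Γ₀, Γ.Isotopic Γ₀ ∧ Cancel Γ₀ Γ'

/-- A strand diagram is reduced if no reduction move applies to it. -/
def StrandDiagram.IsReduced {m n : ℕ} (Γ : StrandDiagram m n) : Prop := ∀ Γ', ¬Reduces Γ Γ'

theorem StrandDiagram.Isotopic.length_eq {m n : ℕ} {Γ Γ' : StrandDiagram m n}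
    (h : Γ.Isotopic Γ') : Γ.verts.length = Γ'.verts.length := by
  induction h with
  | rel _ _ h => obtain ⟨w, w', X, Y, d, h1, h2⟩ := h; simp [h1, h2]
  | refl => rfl
  | symm _ _ _ ih => exact ih.symm
  | trans _ _ _ _ _ ih1 ih2 => exact ih1.trans ih2

theorem Reduces.length_lt {m n : ℕ} {Γ Γ' : StrandDiagram m n} (h : Reduces Γ Γ') :
    Γ'.verts.length < Γ.verts.length := by
  obtain ⟨Γ₀, h1, w, w', j, h2 | h2, h3⟩ := h <;> rw [h1.length_eq, h2, h3] <;> simp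

theorem exists_reduction {m n : ℕ} (Γ : StrandDiagram m n) :
    ∃ Γ', Relation.ReflTransGen Reduces Γ Γ' ∧ Γ'.IsReduced := by
  generalize hk : Γ.verts.length = k
  induction k using Nat.strong_induction_on generalizing Γ with
  | _ k ih =>
    by_cases h : Γ.IsReduced
    · exact ⟨Γ, .refl, h⟩
    · unfold StrandDiagram.IsReduced at h
      push Not at h
      obtain ⟨Γ₁, h1⟩ := h
      obtain ⟨Γ₂, h2, h3⟩ := ih _ (hk ▸ h1.length_lt) Γ₁ rfl
      exact ⟨Γ₂, .head h1 h2, h3⟩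

/-- A reduced diagram obtained from `Γ` by reduction moves (it is unique up to isotopy). -/
noncomputable def StrandDiagram.reduce {m n : ℕ} (Γ : StrandDiagram m n) : StrandDiagram m n :=
  (exists_reduction Γ).choose

/-- The product `Γ₂ * Γ₁`: stacking followed by reduction. -/
noncomputable def StrandDiagram.star {m k n : ℕ} (Γ₂ : StrandDiagram k n)
    (Γ₁ : StrandDiagram m k) : StrandDiagram m n :=
  (Γ₂.comp Γ₁).reduce

/-- The vertices of a tree growing downward from the strand number `p`. -/
def treeVerts : PTree → ℕ → List Vertex
  | .nil, _ => []
  | .node _ l r, p => ⟨.split, p⟩ :: (treeVerts r (p + 1) ++ treeVerts l p)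

theorem fits_treeVerts (T : PTree) (p m : ℕ) (hp : p < m) :
    Fits m (treeVerts T p) (m - 1 + T.numLeaves) := by
  induction T generalizing p m with
  | nil => simp [treeVerts, Fits]; omega
  | node _ l r hl hr =>
    refine ⟨hp, ?_⟩
    have h1 := hr (p + 1) (m - 1 + 2) (by omega)
    have h2 := hl p (m - 1 + 2 - 1 + r.numLeaves) (by omega)
    have e : m - 1 + 2 - 1 + r.numLeaves - 1 + l.numLeaves =
        m - 1 + (l.numLeaves + r.numLeaves) := by omega
    rw [e] at h2
    exact h1.append h2

/-- A tree as a strand diagram containing only splits, with its root at the top. -/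
def treeDiagram (T : PTree) {n : ℕ} (hn : T.numLeaves = n) : StrandDiagram 1 n :=
  ⟨treeVerts T 0, by simpa [hn] using fits_treeVerts T 0 1 one_pos⟩

/-- The `(1, 1)`-strand diagram `T₂* ∘ T₁` of the reduced pair of trees `(T₁, T₂)` of `g`. -/
noncomputable def delta (g : ThompsonF) : StrandDiagram 1 1 :=
  (treeDiagram (treePair g).2 (treePair_spec g).1.numLeaves_eq.symm).reflect.comp
    (treeDiagram (treePair g).1 rfl)

/-- The symmetric tree `S_k` as a strand diagram. -/
def symDiagram (k : ℕ) : StrandDiagram 1 (2 ^ k) := treeDiagram (symTree k) (numLeaves_symTree k)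

/-- Conjugation by the symmetric tree: `Θ_k(g) = S_k * δ(g) * S_k*`. -/
noncomputable def Theta (k : ℕ) (g : ThompsonF) : StrandDiagram (2 ^ k) (2 ^ k) :=
  ((symDiagram k).star (delta g)).star (symDiagram k).reflect

/-! ### Tangles

A `(p, q)`-tangle lies in the slab `ℝ × [0,1] × ℝ`, with coordinates `(x, y, z)`, where `x` is the
horizontal coordinate of the plane of projection, `y` is the height, and `z` points towards the
viewer. Its endpoints are `(i, 1, 0)` for `i < p` and `(i, 0, 0)` for `i < q`. -/

/-- The ambient slab of tangles. -/
abbrev Slab : Type := {p : ℝ × ℝ × ℝ // p.2.1 ∈ Set.Icc (0 : ℝ) 1}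

/-- The endpoints of a `(p, q)`-tangle. -/
def tangleEndpoints (p q : ℕ) : Set (ℝ × ℝ × ℝ) :=
  {P | (∃ i < p, P = ((i : ℝ), 1, 0)) ∨ (∃ i < q, P = ((i : ℝ), 0, 0))}

/-- Isotopy rel endpoints of `(p, q)`-tangles: an ambient isotopy of the slab, starting at the
identity, that fixes the endpoints at all times and carries `S` to `S'`. -/
def TangleIsotopic (p q : ℕ) (S S' : Set (ℝ × ℝ × ℝ)) : Prop :=
  ∃ H : unitInterval → (Slab ≃ₜ Slab),
    Continuous (fun P : unitInterval × Slab => H P.1 P.2) ∧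
    H 0 = Homeomorph.refl Slab ∧
    (∀ t, ∀ P : Slab, (P : ℝ × ℝ × ℝ) ∈ tangleEndpoints p q → H t P = P) ∧
    (H 1) '' ((↑) ⁻¹' S) = (↑) ⁻¹' S'

/-- Concatenation of tangles: `S'` is placed below `S`. -/
def tangleStack (S' S : Set (ℝ × ℝ × ℝ)) : Set (ℝ × ℝ × ℝ) :=
  {P | (1 / 2 ≤ P.2.1 ∧ (P.1, 2 * P.2.1 - 1, P.2.2) ∈ S) ∨
    (P.2.1 ≤ 1 / 2 ∧ (P.1, 2 * P.2.1, P.2.2) ∈ S')}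

/-- The vertical reflection of a tangle. -/
def tangleReflect (S : Set (ℝ × ℝ × ℝ)) : Set (ℝ × ℝ × ℝ) :=
  {P | (P.1, 1 - P.2.1, P.2.2) ∈ S}

/-- `p` vertical strands. -/
def trivialTangle (p : ℕ) : Set (ℝ × ℝ × ℝ) :=
  {P | P.2.1 ∈ Set.Icc (0 : ℝ) 1 ∧ P.2.2 = 0 ∧ ∃ i < p, P.1 = (i : ℝ)}

/-- The convention for crossings at splits and merges: the arc joining the left and the right edge
passes over, or under, the strand that consists of the remaining edge of the strand diagram and of
the edge added in the region between the left and the right edge. -/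
inductive CrossingRule
  | over
  | under

/-- The depth to which the arc joining the left and the right edge is pushed. -/
def CrossingRule.depth : CrossingRule → ℝ
  | .over => 1
  | .under => -1

/-- The `(2n, 2n + 2)`-tangle of the `(n, n + 1)`-strand diagram whose only vertex is a split with
`j` strands to its left. The strand number `i` (counted from `0`) of a strand diagram with `n`
strands becomes the strand number `2i + 1` of the tangle, the edge added in the region between the
strands number `i - 1` and `i` becomes the strand number `2i`, and the strand number `0` is the
trivial strand on the left. The strand entering at the split continues as the edge added in the
new region, and crosses a turnback that joins the left and the right edge of the split. -/
def splitTangle (σ : CrossingRule) (n j : ℕ) : Set (ℝ × ℝ × ℝ) :=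
  {P | P.2.1 ∈ Set.Icc (0 : ℝ) 1 ∧
    ((P.2.2 = 0 ∧ ∃ i < 2 * j + 1, P.1 = (i : ℝ)) ∨
     (P.2.2 = 0 ∧ P.1 = 2 * (j : ℝ) + 1 + (1 - P.2.1)) ∨
     (P.2.2 = 0 ∧ ∃ i, 2 * j + 1 < i ∧ i < 2 * n ∧ P.1 = (i : ℝ) + 2 * (1 - P.2.1)) ∨
     (P.2.1 ≤ 1 / 2 ∧ |P.1 - (2 * (j : ℝ) + 2)| = 1 - 2 * P.2.1 ∧
       P.2.2 = σ.depth * (2 * P.2.1)))}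

/-- The tangle of the strand diagram with `n` strands at the top whose only vertex is `v`. The
tangle of a merge is the vertical reflection of the tangle of a split. -/
def vertexTangle (σ : CrossingRule) (n : ℕ) : Vertex → Set (ℝ × ℝ × ℝ)
  | ⟨.split, j⟩ => splitTangle σ n j
  | ⟨.merge, j⟩ => tangleReflect (splitTangle σ (n - 1) j)

/-- The tangle of a list of vertices, read from top to bottom, with `n` strands at the top. -/
def wordTangle (σ : CrossingRule) : ℕ → List Vertex → Set (ℝ × ℝ × ℝ)
  | n, [] => trivialTangle (2 * n)
  | n, v :: w =>
      tangleStack (wordTangle σ (n - v.kind.ins + v.kind.outs) w) (vertexTangle σ n v)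

/-- The unoriented `(2m, 2n)`-tangle `T(Γ)` of an `(m, n)`-strand diagram: an edge is added in every
region of the complement except for the leftmost and the rightmost one, running from the highest
point (a split, or the top side of the square) to the lowest point (a merge, or the bottom side);
the resulting `4`-valent vertices become crossings, and a trivial strand is added on the left. -/
def StrandDiagram.tangle (σ : CrossingRule) {m n : ℕ} (Γ : StrandDiagram m n) :
    Set (ℝ × ℝ × ℝ) :=
  wordTangle σ m Γ.verts

end Thompson

/-!
The tangles are told apart by the way in which their components join the endpoints, so that the
crossings play no role.

*The strand diagram.* A word of vertices acts on pairs (strand, sequence of binary digits): a split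
reads a digit, a merge writes one (`wordPerm`). The resulting bijection is invariant under isotopy
and reduction. For `Θ_k(g)` it is the prefix exchange of `g`, conjugated by the symmetric tree, and
it determines `g` because `g` acts on binary expansions by this prefix exchange
(`apply_digitValue`, `deltaPerm_injective`). Since `g` is affine on the standard dyadic intervals of
length `2⁻ᵏ`, the bijection of `Θ_k(g)` either only writes or only reads digits on each strand
(`contractsAt_or_expandsAt_Theta`). In a reduced diagram no digit is read that has just been written
(`WordReduced.contractsAt`) and no digit is written that has just been read
(`WordReduced.exists_merge`), which forces a reduced diagram with such a bijection to consist of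
merges followed by splits, up to isotopy (`WordReduced.exists_merges_append_splits`). This replaces
the confluence of the reductions: nothing depends on which reduced diagram was chosen.

*The tangle.* The continuous functions from the tangle to a two-point space, restricted to the
endpoints, form an invariant of the tangle under homeomorphisms of the slab that fix the endpoints
(`TangleIsotopic.colours_iff`). They are the colourings described by the relation `WordRel`, which
is composed from the relations of the single vertices (`wordRel_of_continuousOn`,
`exists_continuousOn_wordTangle`). If all merges lie above all splits, then every colouring of the
strands in between extends downwards through the splits, so that the colourings of the endpoints at
the top depend only on the merges. The merges can be read off from them one after the other, because
a merge at `j` is possible exactly if the endpoints `2 j + 1` and `2 j + 3` always have the same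
colour (`exists_merge_of_topColours`, `wordIso_of_topColours`). By reflection, the
splits can be read off from the colourings at the bottom. Hence the tangle determines the bijection
of the diagram (`wordPerm_eq_of_colours`), and with it the element of `F`.
-/

namespace Thompson

/-! ### Words of vertices up to exchange of heights -/

/-- The exchange of heights of two consecutive vertices, for words of vertices that are not bound
to a fixed number of strands. -/
def WordExchange (w w' : List Vertex) : Prop :=
  ∃ (a b : List Vertex) (X : Vertex) (Y : Kind) (d : ℕ),
    w = a ++ (X :: ⟨Y, X.pos + X.kind.outs + d⟩ :: b) ∧
    w' = a ++ (⟨Y, X.pos + X.kind.ins + d⟩ :: X :: b)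

/-- Isotopy of words of vertices. -/
abbrev WordIso : List Vertex → List Vertex → Prop := Relation.EqvGen WordExchange

theorem WordIso.cons {w w' : List Vertex} (v : Vertex) (h : WordIso w w') :
    WordIso (v :: w) (v :: w') := by
  induction h with
  | rel _ _ h =>
    obtain ⟨a, b, X, Y, d, rfl, rfl⟩ := h
    exact .rel _ _ ⟨v :: a, b, X, Y, d, rfl, rfl⟩
  | refl => exact .refl _
  | symm _ _ _ ih => exact ih.symm
  | trans _ _ _ _ _ h1 h2 => exact h1.trans _ _ _ h2

/-- A vertex that can be moved to the top of a word can be moved above any vertex to the left of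
it. -/
theorem WordIso.move_right {w w' : List Vertex} {X Y : Kind} {p q r : ℕ}
    (hw : WordIso w (⟨Y, q⟩ :: w')) (h : p + X.outs ≤ q) (hr : r + X.outs = q + X.ins) :
    WordIso (⟨X, p⟩ :: w) (⟨Y, r⟩ :: ⟨X, p⟩ :: w') := by
  refine (hw.cons _).trans _ _ _ (.rel _ _ ⟨[], w', ⟨X, p⟩, Y, q - (p + X.outs), ?_, ?_⟩)
  · simp only [List.nil_append]
    congr 3
    omega
  · simp only [List.nil_append]
    congr 2
    omega

/-- A vertex that can be moved to the top of a word can be moved above any vertex to the right of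
it. -/
theorem WordIso.move_left {w w' : List Vertex} {X Y : Kind} {p q r : ℕ}
    (hw : WordIso w (⟨Y, q⟩ :: w')) (h : q + Y.ins ≤ p) (hr : r + Y.ins = p + Y.outs) :
    WordIso (⟨X, p⟩ :: w) (⟨Y, q⟩ :: ⟨X, r⟩ :: w') := by
  refine (hw.cons _).trans _ _ _ (Relation.EqvGen.rel _ _
    ⟨[], w', ⟨Y, q⟩, X, p - (q + Y.ins), ?_, ?_⟩).symm
  · simp only [List.nil_append]
    congr 3
    omega
  · simp only [List.nil_append]
    congr 2
    omega

/-- No word isotopic to `w` contains a cancelling pair of consecutive vertices. -/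
def WordReduced (w : List Vertex) : Prop :=
  ∀ (a b : List Vertex) (j : ℕ),
    ¬WordIso w (a ++ (⟨.split, j⟩ :: ⟨.merge, j⟩ :: b)) ∧
    ¬WordIso w (a ++ (⟨.merge, j⟩ :: ⟨.split, j⟩ :: b))

theorem WordReduced.of_iso {w w' : List Vertex} (h : WordReduced w) (hw : WordIso w w') :
    WordReduced w' := fun a b j =>
  ⟨fun h' => (h a b j).1 (hw.trans _ _ _ h'), fun h' => (h a b j).2 (hw.trans _ _ _ h')⟩

theorem WordReduced.tail {v : Vertex} {w : List Vertex} (h : WordReduced (v :: w)) :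
    WordReduced w := fun a b j =>
  ⟨fun h' => (h (v :: a) b j).1 (h'.cons v), fun h' => (h (v :: a) b j).2 (h'.cons v)⟩

/-! ### The bijection described by a strand diagram

A point of the `i`-th strand is a pair `(i, s)`, where `s` is a sequence of binary digits. As the
number of strands is not recorded, there are infinitely many trivial strands on the right. -/

/-- A split at `p` reads a digit on the strand `p` and sends the point to the left or to the right
edge accordingly. -/
def splitPerm (p : ℕ) : Equiv.Perm (ℕ × Stream' Bool) where
  toFun x := if x.1 < p then x else
    if x.1 = p then (if x.2.head then p + 1 else p, x.2.tail) else (x.1 + 1, x.2)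
  invFun x := if x.1 < p then x else
    if x.1 = p then (p, Stream'.cons false x.2) else
    if x.1 = p + 1 then (p, Stream'.cons true x.2) else (x.1 - 1, x.2)
  left_inv := by
    rintro ⟨i, s⟩
    have hs := Stream'.eta s
    rcases lt_trichotomy i p with h | rfl | h
    · simp [h]
    · cases hb : s.head <;> rw [hb] at hs <;> simp [hb, hs]
    · have h1 : ¬ i < p := by omega
      have h2 : i ≠ p := by omega
      have h3 : ¬ i + 1 < p := by omega
      have h4 : i + 1 ≠ p := by omega
      simp [h1, h2, h3, h4]
  right_inv := by
    rintro ⟨i, s⟩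
    rcases lt_trichotomy i p with h | rfl | h
    · simp [h]
    · simp
    · rcases Nat.lt_or_ge (p + 1) i with h' | h'
      · have h1 : ¬ i < p := by omega
        have h2 : i ≠ p := by omega
        have h3 : ¬ i - 1 < p := by omega
        have h4 : i - 1 ≠ p := by omega
        have h5 : i ≠ p + 1 := by omega
        have h6 : i - 1 + 1 = i := by omega
        simp [h1, h2, h3, h4, h5, h6]
      · obtain rfl : i = p + 1 := by omega
        simp

theorem splitPerm_lt {p i : ℕ} (h : i < p) (s : Stream' Bool) : splitPerm p (i, s) = (i, s) := by
  simp [splitPerm, h]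

theorem splitPerm_false (p : ℕ) (s : Stream' Bool) :
    splitPerm p (p, Stream'.cons false s) = (p, s) := by
  simp [splitPerm]

theorem splitPerm_true (p : ℕ) (s : Stream' Bool) :
    splitPerm p (p, Stream'.cons true s) = (p + 1, s) := by
  simp [splitPerm]

theorem splitPerm_gt {p i : ℕ} (h : p < i) (s : Stream' Bool) :
    splitPerm p (i, s) = (i + 1, s) := by
  have h1 : ¬ i < p := by omega
  have h2 : i ≠ p := by omega
  simp [splitPerm, h1, h2]

/-- The bijection described by a vertex; a merge undoes the split at the same position. -/
def Vertex.perm : Vertex → Equiv.Perm (ℕ × Stream' Bool)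
  | ⟨.split, p⟩ => splitPerm p
  | ⟨.merge, p⟩ => (splitPerm p)⁻¹

/-- The bijection described by a word of vertices, read from top to bottom. -/
def wordPerm : List Vertex → Equiv.Perm (ℕ × Stream' Bool)
  | [] => 1
  | v :: w => wordPerm w * v.perm

theorem wordPerm_append (w w' : List Vertex) :
    wordPerm (w ++ w') = wordPerm w' * wordPerm w := by
  induction w with
  | nil => simp [wordPerm]
  | cons v w ih => simp [wordPerm, ih, mul_assoc]

theorem perm_split_lt {p i : ℕ} (h : i < p) (s : Stream' Bool) :
    Vertex.perm ⟨.split, p⟩ (i, s) = (i, s) := splitPerm_lt h s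

theorem perm_split_false (p : ℕ) (s : Stream' Bool) :
    Vertex.perm ⟨.split, p⟩ (p, Stream'.cons false s) = (p, s) := splitPerm_false p s

theorem perm_split_true (p : ℕ) (s : Stream' Bool) :
    Vertex.perm ⟨.split, p⟩ (p, Stream'.cons true s) = (p + 1, s) := splitPerm_true p s

theorem perm_split_gt {p i : ℕ} (h : p < i) (s : Stream' Bool) :
    Vertex.perm ⟨.split, p⟩ (i, s) = (i + 1, s) := splitPerm_gt h s

theorem perm_merge_lt {p i : ℕ} (h : i < p) (s : Stream' Bool) :
    Vertex.perm ⟨.merge, p⟩ (i, s) = (i, s) := by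
  rw [Vertex.perm, Equiv.Perm.inv_eq_iff_eq, splitPerm_lt h]

theorem perm_merge_left (p : ℕ) (s : Stream' Bool) :
    Vertex.perm ⟨.merge, p⟩ (p, s) = (p, Stream'.cons false s) := by
  rw [Vertex.perm, Equiv.Perm.inv_eq_iff_eq, splitPerm_false]

theorem perm_merge_right (p : ℕ) (s : Stream' Bool) :
    Vertex.perm ⟨.merge, p⟩ (p + 1, s) = (p, Stream'.cons true s) := by
  rw [Vertex.perm, Equiv.Perm.inv_eq_iff_eq, splitPerm_true]

theorem perm_merge_gt {p i : ℕ} (h : p < i) (s : Stream' Bool) :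
    Vertex.perm ⟨.merge, p⟩ (i + 1, s) = (i, s) := by
  rw [Vertex.perm, Equiv.Perm.inv_eq_iff_eq, splitPerm_gt h]

/-- The bijections of splits satisfy the defining relations of Thompson's monoid. -/
theorem splitPerm_mul {p q : ℕ} (h : p < q) :
    splitPerm (q + 1) * splitPerm p = splitPerm p * splitPerm q := by
  ext1 ⟨i, s⟩
  simp only [Equiv.Perm.mul_apply]
  rcases lt_trichotomy i p with h1 | rfl | h1
  · rw [splitPerm_lt h1, splitPerm_lt (p := q + 1) (by omega), splitPerm_lt (p := q) (by omega),
      splitPerm_lt h1]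
  · rw [splitPerm_lt (by omega : i < q), ← Stream'.eta s]
    cases s.head
    · rw [splitPerm_false, splitPerm_lt (by omega)]
    · rw [splitPerm_true, splitPerm_lt (by omega)]
  · rw [splitPerm_gt h1]
    rcases lt_trichotomy i q with h2 | rfl | h2
    · rw [splitPerm_lt (p := q + 1) (by omega), splitPerm_lt (p := q) (by omega), splitPerm_gt h1]
    · rw [← Stream'.eta s]
      cases s.head
      · rw [splitPerm_false, splitPerm_false, splitPerm_gt h1]
      · rw [splitPerm_true, splitPerm_true, splitPerm_gt (by omega)]
    · rw [splitPerm_gt (by omega), splitPerm_gt h2, splitPerm_gt (by omega)]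

theorem perm_swap (X : Vertex) (Y : Kind) (d : ℕ) :
    Vertex.perm ⟨Y, X.pos + X.kind.outs + d⟩ * X.perm =
      X.perm * Vertex.perm ⟨Y, X.pos + X.kind.ins + d⟩ := by
  obtain ⟨X, p⟩ := X
  have key := splitPerm_mul (p := p) (q := p + 1 + d) (by omega)
  have e : p + 2 + d = p + 1 + d + 1 := by omega
  cases X <;> cases Y <;> simp only [Vertex.perm, Kind.ins, Kind.outs, e]
  · exact key
  · rw [inv_mul_eq_iff_eq_mul, ← mul_assoc, key, mul_inv_cancel_right]
  · rw [eq_inv_mul_iff_mul_eq, ← mul_assoc, ← key, mul_inv_cancel_right]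
  · rw [← mul_inv_rev, ← mul_inv_rev, key]

theorem WordIso.perm_eq {w w' : List Vertex} (h : WordIso w w') : wordPerm w = wordPerm w' := by
  induction h with
  | rel _ _ h =>
    obtain ⟨a, b, X, Y, d, rfl, rfl⟩ := h
    simp only [wordPerm_append, wordPerm, mul_assoc]
    rw [← mul_assoc _ X.perm, perm_swap, mul_assoc]
  | refl => rfl
  | symm _ _ _ ih => exact ih.symm
  | trans _ _ _ _ _ h1 h2 => exact h1.trans h2

/-- The word of the vertical reflection of a strand diagram. -/
def reflectWord (w : List Vertex) : List Vertex := w.reverse.map fun v => ⟨v.kind.flip, v.pos⟩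

theorem reflectWord_cons (v : Vertex) (w : List Vertex) :
    reflectWord (v :: w) = reflectWord w ++ [⟨v.kind.flip, v.pos⟩] := by
  simp [reflectWord]

theorem wordPerm_reflectWord (w : List Vertex) : wordPerm (reflectWord w) = (wordPerm w)⁻¹ := by
  induction w with
  | nil => simp [reflectWord, wordPerm]
  | cons v w ih =>
    obtain ⟨k, p⟩ := v
    cases k <;> simp [reflectWord_cons, wordPerm_append, ih, wordPerm, Vertex.perm, Kind.flip]

/-! ### Reduced words -/

/-- On its `p`-th strand, the bijection only adds digits: it maps the strand into a dyadic part of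
a strand. -/
def ContractsAt (f : Equiv.Perm (ℕ × Stream' Bool)) (p : ℕ) : Prop :=
  ∃ (j : ℕ) (u : List Bool), ∀ s, f (p, s) = (j, u ++ₛ s)

/-- On its `p`-th strand, the bijection removes `r` digits and adds none: it maps each of the
`2 ^ r` dyadic parts of the strand onto a strand. -/
def ExpandsAt (f : Equiv.Perm (ℕ × Stream' Bool)) (p r : ℕ) : Prop :=
  ∀ u : List Bool, u.length = r → ∃ j, ∀ s, f (p, u ++ₛ s) = (j, s)

theorem append_cons_stream (u : List Bool) (b : Bool) (s : Stream' Bool) :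
    u ++ₛ Stream'.cons b s = (u ++ [b]) ++ₛ s := by
  simp

theorem get_append_of_const (u : List Bool) (c b : Bool) :
    Stream'.get (u ++ₛ Stream'.cons b (Stream'.const c)) u.length = b ∧
      ∀ n, u.length < n → Stream'.get (u ++ₛ Stream'.cons b (Stream'.const c)) n = c := by
  induction u with
  | nil =>
    refine ⟨rfl, fun n hn => ?_⟩
    obtain ⟨n, rfl⟩ := Nat.exists_eq_add_of_lt hn
    rfl
  | cons a u ih =>
    refine ⟨ih.1, fun n hn => ?_⟩
    cases n with
    | zero => simp at hn
    | succ n => exact ih.2 n (by simpa using hn)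

/-- Two dyadic parts ending with different digits are different. -/
theorem append_cons_ne (u u' : List Bool) (b : Bool) :
    ¬∀ s : Stream' Bool, u ++ₛ Stream'.cons b s = u' ++ₛ Stream'.cons (!b) s := by
  intro h
  obtain ⟨h1, h2⟩ := get_append_of_const u b b
  obtain ⟨h3, h4⟩ := get_append_of_const u' b (!b)
  obtain ⟨h1', h2'⟩ := get_append_of_const u (!b) b
  obtain ⟨h3', h4'⟩ := get_append_of_const u' (!b) (!b)
  rw [h] at h1 h1'
  rcases lt_trichotomy u.length u'.length with hl | hl | hl
  · have := h2 _ hl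
    rw [h, h3] at this
    simp at this
  · rw [hl, h3] at h1
    simp at h1
  · have := h4' _ hl
    rw [h1'] at this
    simp at this

/-- In a reduced word, a strand that is not split further (before it is merged) is contracted. -/
theorem WordReduced.contractsAt {w : List Vertex} {p : ℕ} (h : WordReduced w)
    (hp : ∀ w', ¬WordIso w (⟨.split, p⟩ :: w')) : ContractsAt (wordPerm w) p := by
  induction w generalizing p with
  | nil => exact ⟨p, [], fun s => rfl⟩
  | cons v w ih =>
    obtain ⟨k, q⟩ := v
    cases k with
    | split =>
      rcases lt_trichotomy q p with hq | rfl | hq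
      · obtain ⟨j, u, hu⟩ := ih h.tail (p := p + 1) fun w' hw => hp _ (hw.move_right
          (by simp only [Kind.outs]; omega) (by simp only [Kind.ins, Kind.outs]))
        exact ⟨j, u, fun s => by rw [wordPerm, Equiv.Perm.mul_apply, perm_split_gt hq, hu]⟩
      · exact absurd (.refl _) (hp w)
      · obtain ⟨j, u, hu⟩ := ih h.tail (p := p) fun w' hw => hp _ (hw.move_left (r := q + 1)
          (by simp only [Kind.ins]; omega) (by simp only [Kind.ins, Kind.outs]))
        exact ⟨j, u, fun s => by rw [wordPerm, Equiv.Perm.mul_apply, perm_split_lt hq, hu]⟩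
    | merge =>
      have hred : ∀ w', ¬WordIso w (⟨.split, q⟩ :: w') := fun w' hw => (h [] w' q).2 (hw.cons _)
      rcases lt_trichotomy q p with hq | rfl | hq
      · obtain ⟨p, rfl⟩ : ∃ p', p = p' + 1 := ⟨p - 1, by omega⟩
        rcases Nat.lt_or_ge q p with hq' | hq'
        · obtain ⟨j, u, hu⟩ := ih h.tail (p := p) fun w' hw => hp _ (hw.move_right
            (by simp only [Kind.outs]; omega) (by simp only [Kind.ins, Kind.outs]))
          exact ⟨j, u, fun s => by rw [wordPerm, Equiv.Perm.mul_apply, perm_merge_gt hq', hu]⟩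
        · obtain rfl : q = p := by omega
          obtain ⟨j, u, hu⟩ := ih h.tail hred
          exact ⟨j, u ++ [true], fun s => by
            rw [wordPerm, Equiv.Perm.mul_apply, perm_merge_right, hu, append_cons_stream]⟩
      · obtain ⟨j, u, hu⟩ := ih h.tail hred
        exact ⟨j, u ++ [false], fun s => by
          rw [wordPerm, Equiv.Perm.mul_apply, perm_merge_left, hu, append_cons_stream]⟩
      · obtain ⟨j, u, hu⟩ := ih h.tail (p := p) fun w' hw => hp _ (hw.move_left (r := q + 1)
          (by simp only [Kind.ins]; omega) (by simp only [Kind.ins, Kind.outs]))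
        exact ⟨j, u, fun s => by rw [wordPerm, Equiv.Perm.mul_apply, perm_merge_lt hq, hu]⟩

/-- The strand below a merge of a reduced word is contracted. -/
theorem WordReduced.contractsAt_merge {w : List Vertex} {p : ℕ}
    (h : WordReduced (⟨.merge, p⟩ :: w)) : ContractsAt (wordPerm w) p :=
  h.tail.contractsAt fun w' hw => (h [] w' p).2 (hw.cons _)

theorem perm_apply_of_contractsAt_split {w : List Vertex} {p j : ℕ} {u : List Bool}
    (h : ∀ s, wordPerm (⟨.split, p⟩ :: w) (p, s) = (j, u ++ₛ s)) :
    (∀ s, wordPerm w (p, s) = (j, u ++ₛ Stream'.cons false s)) ∧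
      ∀ s, wordPerm w (p + 1, s) = (j, u ++ₛ Stream'.cons true s) := by
  constructor
  · intro s
    rw [← h, wordPerm, Equiv.Perm.mul_apply, perm_split_false]
  · intro s
    rw [← h, wordPerm, Equiv.Perm.mul_apply, perm_split_true]

/-- If the bijection of a reduced word maps two neighbouring strands onto the two halves of one
dyadic part, then the word begins, up to isotopy, with a merge of these strands. -/
theorem WordReduced.exists_merge {w : List Vertex} {p j : ℕ} {u : List Bool} (h : WordReduced w)
    (h0 : ∀ s, wordPerm w (p, s) = (j, u ++ₛ Stream'.cons false s))
    (h1 : ∀ s, wordPerm w (p + 1, s) = (j, u ++ₛ Stream'.cons true s)) :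
    ∃ w', WordIso w (⟨.merge, p⟩ :: w') := by
  induction w generalizing p j u with
  | nil =>
    have h0 := congrArg Prod.fst (h0 (Stream'.const false))
    have h1 := congrArg Prod.fst (h1 (Stream'.const false))
    simp [wordPerm] at h0 h1
    omega
  | cons v w ih =>
    obtain ⟨k, q⟩ := v
    cases k with
    | split =>
      -- A split on one of the two strands would have to cancel with a merge below it.
      have hK : ∀ (j : ℕ) (u : List Bool),
          ¬∀ s, wordPerm (⟨.split, q⟩ :: w) (q, s) = (j, u ++ₛ s) := by
        intro j u hu
        obtain ⟨e0, e1⟩ := perm_apply_of_contractsAt_split hu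
        obtain ⟨w', hw⟩ := ih h.tail e0 e1
        exact (h [] w' q).1 (hw.cons _)
      rcases lt_trichotomy q p with hq | rfl | hq
      · obtain ⟨w', hw⟩ := ih (p := p + 1) (j := j) (u := u) h.tail
          (fun s => by rw [← h0, wordPerm, Equiv.Perm.mul_apply, perm_split_gt hq])
          (fun s => by rw [← h1, wordPerm, Equiv.Perm.mul_apply, perm_split_gt (by omega)])
        exact ⟨_, hw.move_right (by simp only [Kind.outs]; omega)
          (by simp only [Kind.ins, Kind.outs])⟩
      · exact absurd (fun s => by rw [h0, append_cons_stream]) (hK j (u ++ [false]))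
      · rcases Nat.lt_or_ge (p + 1) q with hq' | hq'
        · obtain ⟨w', hw⟩ := ih (p := p) (j := j) (u := u) h.tail
            (fun s => by rw [← h0, wordPerm, Equiv.Perm.mul_apply, perm_split_lt hq])
            (fun s => by rw [← h1, wordPerm, Equiv.Perm.mul_apply, perm_split_lt hq'])
          exact ⟨_, hw.move_left (r := q - 1) (by simp only [Kind.ins]; omega)
            (by simp only [Kind.ins, Kind.outs]; omega)⟩
        · obtain rfl : q = p + 1 := by omega
          exact absurd (fun s => by rw [h1, append_cons_stream]) (hK j (u ++ [true]))
    | merge =>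
      obtain ⟨j', u', hu⟩ := h.contractsAt_merge
      rcases lt_trichotomy q p with hq | rfl | hq
      · obtain ⟨p, rfl⟩ : ∃ p', p = p' + 1 := ⟨p - 1, by omega⟩
        rcases Nat.lt_or_ge q p with hq' | hq'
        · obtain ⟨w', hw⟩ := ih (p := p) (j := j) (u := u) h.tail
            (fun s => by rw [← h0, wordPerm, Equiv.Perm.mul_apply, perm_merge_gt hq'])
            (fun s => by rw [← h1, wordPerm, Equiv.Perm.mul_apply, perm_merge_gt hq])
          exact ⟨_, hw.move_right (by simp only [Kind.outs]; omega)
            (by simp only [Kind.ins, Kind.outs])⟩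
        · obtain rfl : q = p := by omega
          refine absurd (fun s => ?_) (append_cons_ne u u' false)
          have := h0 s
          rw [wordPerm, Equiv.Perm.mul_apply, perm_merge_right, hu] at this
          exact (congrArg Prod.snd this).symm
      · exact ⟨w, .refl _⟩
      · rcases Nat.lt_or_ge (p + 1) q with hq' | hq'
        · obtain ⟨w', hw⟩ := ih (p := p) (j := j) (u := u) h.tail
            (fun s => by rw [← h0, wordPerm, Equiv.Perm.mul_apply, perm_merge_lt hq])
            (fun s => by rw [← h1, wordPerm, Equiv.Perm.mul_apply, perm_merge_lt hq'])
          exact ⟨_, hw.move_left (r := q - 1) (by simp only [Kind.ins]; omega)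
            (by simp only [Kind.ins, Kind.outs]; omega)⟩
        · obtain rfl : q = p + 1 := by omega
          refine absurd (fun s => ?_) (append_cons_ne u u' true)
          have := h1 s
          rw [wordPerm, Equiv.Perm.mul_apply, perm_merge_left, hu] at this
          exact (congrArg Prod.snd this).symm

/-- A strand of a reduced word that is split is not contracted. -/
theorem WordReduced.not_contractsAt_split {w : List Vertex} {p : ℕ}
    (h : WordReduced (⟨.split, p⟩ :: w)) :
    ¬ContractsAt (wordPerm (⟨.split, p⟩ :: w)) p := by
  rintro ⟨j, u, hu⟩
  obtain ⟨h0, h1⟩ := perm_apply_of_contractsAt_split hu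
  obtain ⟨w', hw⟩ := h.tail.exists_merge h0 h1
  exact (h [] w' p).1 (hw.cons _)

/-- All vertices of the word are of kind `K`. -/
def AllOf (K : Kind) (w : List Vertex) : Prop := ∀ v ∈ w, v.kind = K

theorem AllOf.cons {K : Kind} {w : List Vertex} (h : AllOf K w) (p : ℕ) :
    AllOf K (⟨K, p⟩ :: w) := by
  simpa [AllOf] using h

theorem AllOf.of_cons {K : Kind} {v : Vertex} {w : List Vertex} (h : AllOf K (v :: w)) :
    AllOf K w := fun u hu => h u (List.mem_cons_of_mem v hu)

/-- A strand cannot both be expanded and receive a digit from a merge. -/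
theorem not_expandsAt_of_append {f : Equiv.Perm (ℕ × Stream' Bool)} {p r j : ℕ} {u : List Bool}
    (h : ∀ s, f (p, s) = (j, u ++ₛ s)) (hu : u ≠ []) : ¬ExpandsAt f p r := by
  intro hr
  obtain ⟨j', hj⟩ := hr (List.replicate r false) (by simp)
  obtain ⟨b, l, hl⟩ : ∃ b l, u ++ List.replicate r false = b :: l := by
    cases u with
    | nil => exact absurd rfl hu
    | cons b l => exact ⟨b, l ++ List.replicate r false, rfl⟩
  have := congrArg (fun x => x.2.head) (hj (Stream'.const (!b)))
  rw [h] at this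
  simp only [← Stream'.append_append_stream, hl] at this
  simp [Stream'.cons_append_stream] at this

/-- A split whose two edges are expanded can be moved below all merges. -/
theorem exists_move_split_down {M P : List Vertex} {p r r' : ℕ} (hM : AllOf .merge M)
    (h : WordReduced (M ++ P)) (h0 : ExpandsAt (wordPerm (M ++ P)) p r)
    (h1 : ExpandsAt (wordPerm (M ++ P)) (p + 1) r') :
    ∃ M' p', AllOf .merge M' ∧ WordIso (⟨.split, p⟩ :: (M ++ P)) (M' ++ ⟨.split, p'⟩ :: P) := by
  induction M generalizing p with
  | nil => exact ⟨[], p, hM, .refl _⟩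
  | cons v M ih =>
    obtain ⟨k, q⟩ := v
    obtain rfl : k = .merge := hM ⟨k, q⟩ (by simp)
    have hM' : AllOf .merge M := hM.of_cons
    rw [List.cons_append] at h h0 h1 ⊢
    obtain ⟨j, u, hu⟩ := h.contractsAt_merge
    have hl : ∀ s, wordPerm (⟨.merge, q⟩ :: (M ++ P)) (q, s) = (j, (u ++ [false]) ++ₛ s) := by
      intro s
      rw [wordPerm, Equiv.Perm.mul_apply, perm_merge_left, hu, append_cons_stream]
    have hr : ∀ s, wordPerm (⟨.merge, q⟩ :: (M ++ P)) (q + 1, s) = (j, (u ++ [true]) ++ₛ s) := by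
      intro s
      rw [wordPerm, Equiv.Perm.mul_apply, perm_merge_right, hu, append_cons_stream]
    have n1 : p ≠ q := by
      rintro rfl
      exact not_expandsAt_of_append hl (by simp) h0
    have n2 : p ≠ q + 1 := by
      rintro rfl
      exact not_expandsAt_of_append hr (by simp) h0
    have n3 : p + 1 ≠ q := by
      rintro rfl
      exact not_expandsAt_of_append hl (by simp) h1
    rcases Nat.lt_or_ge p q with hq | hq
    · obtain ⟨M', p', h2, h3⟩ := ih (p := p) hM' h.tail
        (fun x hx => by
          obtain ⟨i, hi⟩ := h0 x hx
          exact ⟨i, fun s => by rw [← hi, wordPerm, Equiv.Perm.mul_apply, perm_merge_lt hq]⟩)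
        (fun x hx => by
          obtain ⟨i, hi⟩ := h1 x hx
          exact ⟨i, fun s => by
            rw [← hi, wordPerm, Equiv.Perm.mul_apply, perm_merge_lt (by omega)]⟩)
      refine ⟨⟨.merge, q - 1⟩ :: M', p', h2.cons _, .trans _ _ _ ?_ (h3.cons _)⟩
      exact WordIso.move_right (.refl _) (by simp only [Kind.outs]; omega)
        (by simp only [Kind.ins, Kind.outs]; omega)
    · obtain ⟨p, rfl⟩ : ∃ p', p = p' + 1 := ⟨p - 1, by omega⟩
      obtain ⟨M', p', h2, h3⟩ := ih (p := p) hM' h.tail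
        (fun x hx => by
          obtain ⟨i, hi⟩ := h0 x hx
          exact ⟨i, fun s => by
            rw [← hi, wordPerm, Equiv.Perm.mul_apply, perm_merge_gt (by omega)]⟩)
        (fun x hx => by
          obtain ⟨i, hi⟩ := h1 x hx
          exact ⟨i, fun s => by
            rw [← hi, wordPerm, Equiv.Perm.mul_apply, perm_merge_gt (by omega)]⟩)
      refine ⟨⟨.merge, q⟩ :: M', p', h2.cons _, .trans _ _ _ ?_ (h3.cons _)⟩
      exact WordIso.move_left (.refl _) (by simp only [Kind.ins]; omega)
        (by simp only [Kind.ins, Kind.outs])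

/-- If every strand of a reduced word is contracted or expanded, then the word is isotopic to one
in which all merges lie above all splits. -/
theorem WordReduced.exists_merges_append_splits {w : List Vertex} (h : WordReduced w)
    (hw : ∀ p, ContractsAt (wordPerm w) p ∨ ∃ r, ExpandsAt (wordPerm w) p r) :
    ∃ M P, AllOf .merge M ∧ AllOf .split P ∧ WordIso w (M ++ P) := by
  induction w with
  | nil => exact ⟨[], [], by simp [AllOf], by simp [AllOf], .refl _⟩
  | cons v w ih =>
    obtain ⟨k, q⟩ := v
    -- Strands that miss the vertex are unchanged.
    have transfer : ∀ p p', (∀ s, Vertex.perm ⟨k, q⟩ (p', s) = (p, s)) →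
        ContractsAt (wordPerm w) p ∨ ∃ r, ExpandsAt (wordPerm w) p r := by
      intro p p' hp
      rcases hw p' with ⟨j, u, hu⟩ | ⟨r, hr⟩
      · exact .inl ⟨j, u, fun s => by rw [← hu, wordPerm, Equiv.Perm.mul_apply, hp]⟩
      · refine .inr ⟨r, fun x hx => ?_⟩
        obtain ⟨i, hi⟩ := hr x hx
        exact ⟨i, fun s => by rw [← hi, wordPerm, Equiv.Perm.mul_apply, hp]⟩
    cases k with
    | merge =>
      obtain ⟨M, P, hM, hP, hi⟩ := ih h.tail fun p => by
        rcases lt_trichotomy p q with hq | rfl | hq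
        · exact transfer p p (perm_merge_lt hq)
        · exact .inl h.contractsAt_merge
        · exact transfer p (p + 1) (perm_merge_gt hq)
      exact ⟨⟨.merge, q⟩ :: M, P, hM.cons _, hP, hi.cons _⟩
    | split =>
      obtain ⟨r, hr⟩ := (hw q).resolve_left h.not_contractsAt_split
      obtain ⟨r, rfl⟩ : ∃ r', r = r' + 1 := by
        refine ⟨r - 1, ?_⟩
        rcases Nat.eq_zero_or_pos r with rfl | h0
        · obtain ⟨j, hj⟩ := hr [] rfl
          exact absurd ⟨j, [], hj⟩ h.not_contractsAt_split
        · omega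
      have e0 : ExpandsAt (wordPerm w) q r := fun x hx => by
        obtain ⟨i, hi⟩ := hr (false :: x) (by simp [hx])
        exact ⟨i, fun s => by
          rw [← hi, wordPerm, Equiv.Perm.mul_apply, Stream'.cons_append_stream,
            perm_split_false]⟩
      have e1 : ExpandsAt (wordPerm w) (q + 1) r := fun x hx => by
        obtain ⟨i, hi⟩ := hr (true :: x) (by simp [hx])
        exact ⟨i, fun s => by
          rw [← hi, wordPerm, Equiv.Perm.mul_apply, Stream'.cons_append_stream,
            perm_split_true]⟩
      obtain ⟨M, P, hM, hP, hi⟩ := ih h.tail fun p => by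
        rcases lt_trichotomy p q with hq | rfl | hq
        · exact transfer p p (perm_split_lt hq)
        · exact .inr ⟨r, e0⟩
        · rcases Nat.lt_or_ge (q + 1) p with hq' | hq'
          · obtain ⟨p, rfl⟩ : ∃ p', p = p' + 1 := ⟨p - 1, by omega⟩
            exact transfer (p + 1) p (perm_split_gt (by omega))
          · obtain rfl : p = q + 1 := by omega
            exact .inr ⟨r, e1⟩
      rw [hi.perm_eq] at e0 e1
      obtain ⟨M', p', h2, h3⟩ := exists_move_split_down hM (h.tail.of_iso hi) e0 e1
      exact ⟨M', ⟨.split, p'⟩ :: P, h2, hP.cons _, (hi.cons _).trans _ _ _ h3⟩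

/-! ### Colourings of the strands of a tangle -/

/-- `t` and `b` are the colours of the endpoints at the top and at the bottom of the tangle of the
split at `j` for a two-colouring that is constant on each of its strands. The strands
to the right of the vertex go on forever, so that the number of strands need not be recorded. -/
def SplitRel (j : ℕ) (t b : ℕ → Bool) : Prop :=
  (∀ i < 2 * j + 1, b i = t i) ∧ b (2 * j + 2) = t (2 * j + 1) ∧
    b (2 * j + 1) = b (2 * j + 3) ∧ ∀ i, 2 * j + 1 < i → b (i + 2) = t i

/-- Colourings of the tangle of a vertex. -/
def VertexRel : Vertex → (ℕ → Bool) → (ℕ → Bool) → Prop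
  | ⟨.split, j⟩, t, b => SplitRel j t b
  | ⟨.merge, j⟩, t, b => SplitRel j b t

/-- Colourings of the tangle of a word of vertices. -/
def WordRel : List Vertex → (ℕ → Bool) → (ℕ → Bool) → Prop
  | [], t, b => t = b
  | v :: w, t, b => ∃ c, VertexRel v t c ∧ WordRel w c b

theorem wordRel_append {w w' : List Vertex} {t b : ℕ → Bool} :
    WordRel (w ++ w') t b ↔ ∃ c, WordRel w t c ∧ WordRel w' c b := by
  induction w generalizing t with
  | nil => simp [WordRel]
  | cons v w ih =>
    simp only [List.cons_append, WordRel, ih]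
    constructor
    · rintro ⟨c, h1, d, h2, h3⟩
      exact ⟨d, ⟨c, h1, h2⟩, h3⟩
    · rintro ⟨d, ⟨c, h1, h2⟩, h3⟩
      exact ⟨c, h1, d, h2, h3⟩

theorem vertexRel_swap (X : Vertex) (Y : Kind) (d : ℕ) (t b : ℕ → Bool) :
    (∃ c, VertexRel X t c ∧ VertexRel ⟨Y, X.pos + X.kind.outs + d⟩ c b) ↔
      ∃ c, VertexRel ⟨Y, X.pos + X.kind.ins + d⟩ t c ∧ VertexRel X c b := by
  obtain ⟨X, p⟩ := X
  constructor
  · rintro ⟨c, h1, h2⟩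
    refine ⟨fun i => if i < 2 * p + 2 * X.ins then t i else b (i - 2 * X.ins + 2 * X.outs), ?_, ?_⟩
    · cases X <;> cases Y <;> simp only [VertexRel, SplitRel, Kind.ins, Kind.outs] at * <;> grind
    · cases X <;> cases Y <;> simp only [VertexRel, SplitRel, Kind.ins, Kind.outs] at * <;> grind
  · rintro ⟨c, h1, h2⟩
    refine ⟨fun i => if i < 2 * p + 2 * X.outs then b i else t (i - 2 * X.outs + 2 * X.ins), ?_, ?_⟩
    · cases X <;> cases Y <;> simp only [VertexRel, SplitRel, Kind.ins, Kind.outs] at * <;> grind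
    · cases X <;> cases Y <;> simp only [VertexRel, SplitRel, Kind.ins, Kind.outs] at * <;> grind

theorem WordIso.wordRel_iff {w w' : List Vertex} (h : WordIso w w') (t b : ℕ → Bool) :
    WordRel w t b ↔ WordRel w' t b := by
  induction h generalizing t b with
  | rel _ _ h =>
    obtain ⟨x, y, X, Y, d, rfl, rfl⟩ := h
    have key : ∀ t b, WordRel (X :: ⟨Y, X.pos + X.kind.outs + d⟩ :: y) t b ↔
        WordRel (⟨Y, X.pos + X.kind.ins + d⟩ :: X :: y) t b := by
      intro t b
      change (∃ c, _ ∧ ∃ c', _ ∧ _) ↔ (∃ c, _ ∧ ∃ c', _ ∧ _)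
      constructor
      · rintro ⟨c, h1, c', h2, h3⟩
        obtain ⟨e, h4, h5⟩ := (vertexRel_swap X Y d t c').1 ⟨c, h1, h2⟩
        exact ⟨e, h4, c', h5, h3⟩
      · rintro ⟨c, h1, c', h2, h3⟩
        obtain ⟨e, h4, h5⟩ := (vertexRel_swap X Y d t c').2 ⟨c, h1, h2⟩
        exact ⟨e, h4, c', h5, h3⟩
    simp only [wordRel_append, key]
  | refl => rfl
  | symm _ _ _ ih => exact (ih t b).symm
  | trans _ _ _ _ _ h1 h2 => exact (h1 t b).trans (h2 t b)

theorem wordRel_reflectWord {w : List Vertex} {t b : ℕ → Bool} :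
    WordRel (reflectWord w) t b ↔ WordRel w b t := by
  induction w generalizing b with
  | nil => exact eq_comm
  | cons v w ih =>
    obtain ⟨k, p⟩ := v
    rw [reflectWord_cons, wordRel_append]
    cases k <;> simp only [ih, WordRel, VertexRel, Kind.flip, exists_eq_right, and_comm]

/-- The colours that the endpoints at the top can have. -/
def TopColours (w : List Vertex) (t : ℕ → Bool) : Prop := ∃ b, WordRel w t b

/-- The colours that the endpoints at the bottom can have. -/
def BottomColours (w : List Vertex) (b : ℕ → Bool) : Prop := ∃ t, WordRel w t b

theorem exists_splitRel (j : ℕ) (t : ℕ → Bool) : ∃ b, SplitRel j t b := by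
  refine ⟨fun i => if i < 2 * j + 1 then t i else if i < 2 * j + 4 then t (2 * j + 1)
    else t (i - 2), ?_⟩
  unfold SplitRel
  grind

/-- Every colouring at the top extends through splits. -/
theorem exists_wordRel_of_splits {P : List Vertex} (hP : AllOf .split P) (t : ℕ → Bool) :
    ∃ b, WordRel P t b := by
  induction P generalizing t with
  | nil => exact ⟨t, rfl⟩
  | cons v P ih =>
    obtain ⟨k, p⟩ := v
    obtain rfl : k = .split := hP ⟨k, p⟩ (by simp)
    obtain ⟨c, hc⟩ := exists_splitRel p t
    obtain ⟨b, hb⟩ := ih hP.of_cons c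
    exact ⟨b, c, hc, hb⟩

theorem AllOf.reflectWord {w : List Vertex} {K : Kind} (h : AllOf K w) :
    AllOf K.flip (reflectWord w) := by
  intro v hv
  obtain ⟨u, hu, rfl⟩ := List.mem_map.1 hv
  change u.kind.flip = _
  rw [h u (by simpa using hu)]

theorem topColours_append {M P : List Vertex} (hP : AllOf .split P) (t : ℕ → Bool) :
    TopColours (M ++ P) t ↔ TopColours M t := by
  simp only [TopColours, wordRel_append]
  constructor
  · rintro ⟨b, c, h1, -⟩
    exact ⟨c, h1⟩
  · rintro ⟨c, h1⟩
    obtain ⟨b, hb⟩ := exists_wordRel_of_splits hP c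
    exact ⟨b, c, h1, hb⟩

theorem bottomColours_append {M P : List Vertex} (hM : AllOf .merge M) (b : ℕ → Bool) :
    BottomColours (M ++ P) b ↔ TopColours (reflectWord P) b := by
  simp only [BottomColours, TopColours, wordRel_append, wordRel_reflectWord]
  constructor
  · rintro ⟨t, c, -, h1⟩
    exact ⟨c, h1⟩
  · rintro ⟨c, h1⟩
    obtain ⟨t, ht⟩ := exists_wordRel_of_splits hM.reflectWord c
    exact ⟨t, c, wordRel_reflectWord.1 ht, h1⟩

theorem topColours_const {M : List Vertex} (hM : AllOf .merge M) (c : Bool) :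
    TopColours M fun _ => c := by
  induction M with
  | nil => exact ⟨_, rfl⟩
  | cons v M ih =>
    obtain ⟨k, p⟩ := v
    obtain rfl : k = .merge := hM ⟨k, p⟩ (by simp)
    obtain ⟨b, hb⟩ := ih hM.of_cons
    exact ⟨b, fun _ => c, by simp [VertexRel, SplitRel], hb⟩

theorem topColours_cons {v : Vertex} {w : List Vertex} {t : ℕ → Bool} :
    TopColours (v :: w) t ↔ ∃ c, VertexRel v t c ∧ TopColours w c := by
  constructor
  · rintro ⟨b, c, h1, h2⟩
    exact ⟨c, h1, b, h2⟩
  · rintro ⟨c, h1, b, h2⟩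
    exact ⟨b, c, h1, h2⟩

/-- If a word of merges joins the two endpoints that a merge at `j` would join, then it begins, up
to isotopy, with this merge. -/
theorem exists_merge_of_topColours {M : List Vertex} (hM : AllOf .merge M) {j : ℕ}
    (h : ∀ t, TopColours M t → t (2 * j + 1) = t (2 * j + 3)) :
    ∃ M', AllOf .merge M' ∧ WordIso M (⟨.merge, j⟩ :: M') := by
  induction M generalizing j with
  | nil =>
    have := h (fun i => decide (i = 2 * j + 1)) ⟨_, rfl⟩
    simp at this
  | cons v M ih =>
    obtain ⟨k, i⟩ := v
    obtain rfl : k = .merge := hM ⟨k, i⟩ (by simp)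
    have hM' : AllOf .merge M := hM.of_cons
    by_cases hij : i = j
    · subst hij
      exact ⟨M, hM', .refl _⟩
    -- The arc of the merge at `i` has no other endpoints, so it can be coloured on its own.
    have n : i ≠ j + 1 ∧ j ≠ i + 1 := by
      have := h (fun l => decide (l = 2 * i + 1 ∨ l = 2 * i + 3)) (topColours_cons.2
        ⟨fun _ => false, by simp [VertexRel, SplitRel]; grind, topColours_const hM' _⟩)
      constructor
      · rintro rfl
        grind
      · rintro rfl
        grind
    rcases Nat.lt_or_ge i j with hlt | hge
    · obtain ⟨j, rfl⟩ : ∃ j', j = j' + 1 := ⟨j - 1, by omega⟩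
      obtain ⟨M', h1, h2⟩ := ih (j := j) hM' fun t ht => by
        obtain ⟨c, hc⟩ := exists_splitRel i t
        have := h c (topColours_cons.2 ⟨t, hc, ht⟩)
        have h3 := hc.2.2.2 (2 * j + 1) (by omega)
        have h4 := hc.2.2.2 (2 * j + 3) (by omega)
        rw [← h3, ← h4]
        exact this
      exact ⟨⟨.merge, i⟩ :: M', h1.cons _,
        h2.move_right (by simp only [Kind.outs]; omega) (by simp only [Kind.ins, Kind.outs])⟩
    · obtain ⟨M', h1, h2⟩ := ih (j := j) hM' fun t ht => by
        obtain ⟨c, hc⟩ := exists_splitRel i t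
        have := h c (topColours_cons.2 ⟨t, hc, ht⟩)
        have h3 := hc.1 (2 * j + 1) (by omega)
        have h4 := hc.1 (2 * j + 3) (by omega)
        rw [← h3, ← h4]
        exact this
      exact ⟨⟨.merge, i - 1⟩ :: M', h1.cons _, h2.move_left (by simp only [Kind.ins]; omega)
        (by simp only [Kind.ins, Kind.outs]; omega)⟩

/-- A word of merges is determined, up to isotopy, by the way in which its tangle joins the
endpoints at the top. -/
theorem wordIso_of_topColours {M M' : List Vertex} (hM : AllOf .merge M) (hM' : AllOf .merge M')
    (h : ∀ t, TopColours M t ↔ TopColours M' t) : WordIso M M' := by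
  induction M generalizing M' with
  | nil =>
    cases M' with
    | nil => exact .refl _
    | cons v M' =>
      exfalso
      obtain ⟨k, j⟩ := v
      obtain rfl : k = .merge := hM' ⟨k, j⟩ (by simp)
      obtain ⟨c, hc, -⟩ := topColours_cons.1
        ((h fun i => decide (i = 2 * j + 1)).1 ⟨_, rfl⟩)
      have := hc.2.2.1
      simp at this
  | cons v M ih =>
    obtain ⟨k, j⟩ := v
    obtain rfl : k = .merge := hM ⟨k, j⟩ (by simp)
    obtain ⟨M'', h1, h2⟩ := exists_merge_of_topColours hM' (j := j) fun t ht => by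
      obtain ⟨c, hc, -⟩ := topColours_cons.1 ((h t).2 ht)
      exact hc.2.2.1
    -- The merge at `j` can be removed because each colouring below it comes from one above it.
    have key : ∀ {N N' : List Vertex}, (∀ t, TopColours (⟨.merge, j⟩ :: N) t →
        TopColours (⟨.merge, j⟩ :: N') t) → ∀ t, TopColours N t → TopColours N' t := by
      intro N N' hN t ht
      obtain ⟨c, hc⟩ := exists_splitRel j t
      obtain ⟨t', ht', h3⟩ := topColours_cons.1 (hN c (topColours_cons.2 ⟨t, hc, ht⟩))
      convert h3 using 1
      funext i
      change SplitRel j t' c at ht'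
      unfold SplitRel at hc ht'
      rcases lt_trichotomy i (2 * j + 1) with hi | rfl | hi
      · rw [← hc.1 i hi, ht'.1 i hi]
      · rw [← hc.2.1, ht'.2.1]
      · rw [← hc.2.2.2 i hi, ht'.2.2.2 i hi]
    have h' : ∀ t, TopColours (⟨.merge, j⟩ :: M) t ↔ TopColours (⟨.merge, j⟩ :: M'') t :=
      fun t => (h t).trans (exists_congr fun b => h2.wordRel_iff t b)
    exact ((ih hM.of_cons h1 fun t =>
      ⟨key (fun t => (h' t).1) t, key (fun t => (h' t).2) t⟩).cons _).trans _ _ _ h2.symm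

/-- The bijection of a diagram with all merges above all splits is determined by the colourings of
the endpoints of its tangle. -/
theorem wordPerm_eq_of_colours {w w' : List Vertex} {M P M' P' : List Vertex}
    (hM : AllOf .merge M) (hP : AllOf .split P) (hw : WordIso w (M ++ P))
    (hM' : AllOf .merge M') (hP' : AllOf .split P') (hw' : WordIso w' (M' ++ P'))
    (ht : ∀ t, TopColours w t ↔ TopColours w' t)
    (hb : ∀ b, BottomColours w b ↔ BottomColours w' b) : wordPerm w = wordPerm w' := by
  have h1 : WordIso M M' := wordIso_of_topColours hM hM' fun t => by
    rw [← topColours_append (M := M) hP, ← topColours_append (M := M') hP']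
    exact (exists_congr fun b => (hw.wordRel_iff t b).symm).trans
      ((ht t).trans (exists_congr fun b => hw'.wordRel_iff t b))
  have h2 : WordIso (reflectWord P) (reflectWord P') :=
    wordIso_of_topColours hP.reflectWord hP'.reflectWord fun b => by
      rw [← bottomColours_append (P := P) hM, ← bottomColours_append (P := P') hM']
      exact (exists_congr fun t => (hw.wordRel_iff t b).symm).trans
        ((hb b).trans (exists_congr fun t => hw'.wordRel_iff t b))
  have e2 := h2.perm_eq
  rw [wordPerm_reflectWord, wordPerm_reflectWord, inv_inj] at e2
  rw [hw.perm_eq, hw'.perm_eq, wordPerm_append, wordPerm_append, h1.perm_eq, e2]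

/-! ### Two-colourings of the tangle as continuous functions -/

/-- The values of `F` at the first `p` endpoints on the line `y = a`, followed by `τ`. -/
def endColours (F : ℝ × ℝ × ℝ → Bool) (p : ℕ) (a : ℝ) (τ : ℕ → Bool) (i : ℕ) : Bool :=
  if i < p then F ((i : ℝ), a, 0) else τ (i - p)

/-- A continuous function to a discrete space takes equal values at the two ends of a path. -/
theorem ContinuousOn.eq_of_path {F : ℝ × ℝ × ℝ → Bool} {S : Set (ℝ × ℝ × ℝ)}
    (hF : ContinuousOn F S) {γ : ℝ → ℝ × ℝ × ℝ} (hγ : Continuous γ) {a b : ℝ} (hab : a ≤ b)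
    (h : ∀ x ∈ Set.Icc a b, γ x ∈ S) : F (γ a) = F (γ b) :=
  (isPreconnected_Icc (a := a) (b := b)).constant (hF.comp hγ.continuousOn h)
    (Set.left_mem_Icc.2 hab) (Set.right_mem_Icc.2 hab)

theorem splitRel_of_continuousOn {σ : CrossingRule} {n j : ℕ} (hj : j < n)
    {F : ℝ × ℝ × ℝ → Bool} (hF : ContinuousOn F (splitTangle σ n j)) (τ : ℕ → Bool) :
    SplitRel j (endColours F (2 * n) 1 τ) (endColours F (2 * (n + 1)) 0 τ) := by
  refine ⟨fun i hi => ?_, ?_, ?_, fun i hi => ?_⟩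
  · rw [endColours, endColours, if_pos (by omega), if_pos (by omega)]
    refine ContinuousOn.eq_of_path hF (γ := fun y => ((i : ℝ), y, 0)) (by fun_prop) zero_le_one ?_
    exact fun y hy => ⟨hy, .inl ⟨rfl, i, hi, rfl⟩⟩
  · rw [endColours, endColours, if_pos (by omega), if_pos (by omega)]
    have := ContinuousOn.eq_of_path hF (γ := fun y => (2 * (j : ℝ) + 1 + (1 - y), y, 0))
      (by fun_prop) zero_le_one fun y hy => ⟨hy, .inr (.inl ⟨rfl, rfl⟩)⟩
    push_cast
    convert this using 3 <;> ring
  · rw [endColours, endColours, if_pos (by omega), if_pos (by omega)]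
    have := ContinuousOn.eq_of_path hF
      (γ := fun x => (2 * (j : ℝ) + 2 + x, (1 - |x|) / 2, σ.depth * (1 - |x|)))
      (by fun_prop) (by norm_num : (-1 : ℝ) ≤ 1) fun x hx => by
        have h1 : |x| ≤ 1 := abs_le.2 hx
        have h2 := abs_nonneg x
        refine ⟨⟨?_, ?_⟩, .inr (.inr (.inr ⟨?_, ?_, ?_⟩))⟩ <;> simp only
        · linarith
        · linarith
        · linarith
        · rw [show 2 * (j : ℝ) + 2 + x - (2 * j + 2) = x by ring]
          ring
        · ring
    push_cast
    norm_num at this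
    convert this using 3 <;> ring
  · rw [endColours, endColours]
    by_cases h : i < 2 * n
    · rw [if_pos h, if_pos (by omega)]
      have := ContinuousOn.eq_of_path hF (γ := fun y => ((i : ℝ) + 2 * (1 - y), y, 0))
        (by fun_prop) zero_le_one fun y hy => ⟨hy, .inr (.inr (.inl ⟨rfl, i, hi, h, rfl⟩))⟩
      push_cast
      convert this using 3 <;> ring
    · rw [if_neg h, if_neg (by omega)]
      congr 1
      omega

/-- The part of the tangle of a split that consists of the strands joining the top to the
bottom. -/
def splitStrands (n j : ℕ) : Set (ℝ × ℝ × ℝ) :=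
  {P | P.2.1 ∈ Set.Icc (0 : ℝ) 1 ∧ P.2.2 = 0 ∧
    ((∃ i < 2 * j + 1, P.1 = (i : ℝ)) ∨ P.1 = 2 * (j : ℝ) + 1 + (1 - P.2.1) ∨
      ∃ i, 2 * j + 1 < i ∧ i < 2 * n ∧ P.1 = (i : ℝ) + 2 * (1 - P.2.1))}

/-- The turnback in the tangle of a split. -/
def splitArc (σ : CrossingRule) (j : ℕ) : Set (ℝ × ℝ × ℝ) :=
  {P | P.2.1 ∈ Set.Icc (0 : ℝ) 1 ∧ P.2.1 ≤ 1 / 2 ∧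
    |P.1 - (2 * (j : ℝ) + 2)| = 1 - 2 * P.2.1 ∧ P.2.2 = σ.depth * (2 * P.2.1)}

theorem splitTangle_eq (σ : CrossingRule) (n j : ℕ) :
    splitTangle σ n j = splitStrands n j ∪ splitArc σ j := by
  ext P
  simp only [splitTangle, splitStrands, splitArc, Set.mem_union, Set.mem_ofPred_eq]
  rw [← and_or_left]
  refine and_congr_right fun _ => ?_
  rw [and_or_left, and_or_left, or_assoc, or_assoc]

theorem isClosed_height : IsClosed {P : ℝ × ℝ × ℝ | P.2.1 ∈ Set.Icc (0 : ℝ) 1} :=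
  isClosed_Icc.preimage (by fun_prop)

theorem isClosed_splitArc (σ : CrossingRule) (j : ℕ) : IsClosed (splitArc σ j) :=
  isClosed_height.and <| (isClosed_le (by fun_prop) (by fun_prop)).and <|
    (isClosed_eq (by fun_prop) (by fun_prop)).and (isClosed_eq (by fun_prop) (by fun_prop))

theorem isClosed_exists_lt (p : ℕ) {Q : ℕ → ℝ × ℝ × ℝ → Prop} (h : ∀ i, IsClosed {P | Q i P}) :
    IsClosed {P | ∃ i < p, Q i P} := by
  have : {P | ∃ i < p, Q i P} = ⋃ i ∈ Set.Iio p, {P | Q i P} := by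
    ext P
    simp
  rw [this]
  exact (Set.finite_Iio p).isClosed_biUnion fun i _ => h i

theorem isClosed_or {Q R : ℝ × ℝ × ℝ → Prop} (hQ : IsClosed {P | Q P})
    (hR : IsClosed {P | R P}) : IsClosed {P | Q P ∨ R P} := hQ.union hR

theorem isClosed_splitStrands (n j : ℕ) : IsClosed (splitStrands n j) := by
  have h := isClosed_exists_lt (2 * n)
    (Q := fun i P => 2 * j + 1 < i ∧ P.1 = (i : ℝ) + 2 * (1 - P.2.1))
    fun i => isClosed_const.and (isClosed_eq (by fun_prop) (by fun_prop))
  simp only [and_left_comm (a := _ < 2 * n)] at h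
  exact isClosed_height.and <| (isClosed_eq (by fun_prop) (by fun_prop)).and <|
    isClosed_or (isClosed_exists_lt _ fun i => isClosed_eq (by fun_prop) (by fun_prop)) <|
    isClosed_or (isClosed_eq (by fun_prop) (by fun_prop)) h

theorem isClosed_splitTangle (σ : CrossingRule) (n j : ℕ) : IsClosed (splitTangle σ n j) := by
  rw [splitTangle_eq]
  exact (isClosed_splitStrands n j).union (isClosed_splitArc σ j)

theorem CrossingRule.depth_ne_zero (σ : CrossingRule) : σ.depth ≠ 0 := by
  cases σ <;> simp [CrossingRule.depth]

theorem bottom_of_splitArc {σ : CrossingRule} {j : ℕ} {P : ℝ × ℝ × ℝ} (hP : P ∈ splitArc σ j)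
    (h : P.2.2 = 0 ∨ P.2.1 = 0) :
    P = (((2 * j + 1 : ℕ) : ℝ), 0, 0) ∨ P = (((2 * j + 3 : ℕ) : ℝ), 0, 0) := by
  obtain ⟨x, y, z⟩ := P
  obtain ⟨-, -, h1, h2⟩ := hP
  simp only at h h1 h2
  have hy : y = 0 := by
    rcases h with h | h
    · rw [h] at h2
      have := (mul_eq_zero.1 h2.symm).resolve_left σ.depth_ne_zero
      linarith
    · exact h
  subst hy
  simp only [mul_zero, sub_zero] at h1 h2
  subst h2
  rcases (abs_eq one_pos.le).1 h1 with h | h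
  · right
    simp only [Prod.mk.injEq, and_true]
    push_cast
    linarith
  · left
    simp only [Prod.mk.injEq, and_true]
    push_cast
    linarith

theorem splitArc_disjoint {σ : CrossingRule} {n j : ℕ} {P : ℝ × ℝ × ℝ}
    (hP : P ∈ splitStrands n j) : P ∉ splitArc σ j := by
  intro hP'
  obtain ⟨-, hz, h⟩ := hP
  rcases bottom_of_splitArc hP' (.inl hz) with rfl | rfl
  all_goals
    simp only [sub_zero, mul_one] at h
    rcases h with ⟨i, hi, h⟩ | h | ⟨i, hi, -, h⟩
    · have h : 2 * j + 1 = i ∨ 2 * j + 3 = i := by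
        first | left; exact_mod_cast h | right; exact_mod_cast h
      omega
    · norm_cast at h
      omega
    · norm_cast at h
      omega

theorem continuousOn_comp_floor (t : ℕ → Bool) :
    ContinuousOn (fun x : ℝ => t ⌊x⌋₊) (Set.range ((↑) : ℕ → ℝ)) := by
  rintro _ ⟨k, rfl⟩
  refine (continuousWithinAt_const (b := t k)).congr_of_eventuallyEq ?_ (by simp)
  filter_upwards [self_mem_nhdsWithin, mem_nhdsWithin_of_mem_nhds (Metric.ball_mem_nhds _ one_pos)]
  rintro _ ⟨l, rfl⟩ hl
  rw [Metric.mem_ball, Nat.dist_cast_real, Nat.dist_eq] at hl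
  have : |(l : ℤ) - k| < 1 := by exact_mod_cast hl
  rw [Int.abs_lt_one_iff] at this
  obtain rfl : l = k := by omega
  simp

/-- The number of the endpoint at the top from which a strand of the tangle of a split comes, as a
function of the point on the strand. -/
noncomputable def splitSource (j : ℕ) (P : ℝ × ℝ × ℝ) : ℝ :=
  min P.1 (max (2 * j + 1) (P.1 - 2 * (1 - P.2.1)))

theorem splitSource_mem_range {n j : ℕ} {P : ℝ × ℝ × ℝ} (hP : P ∈ splitStrands n j) :
    splitSource j P ∈ Set.range ((↑) : ℕ → ℝ) := by
  obtain ⟨x, y, z⟩ := P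
  obtain ⟨⟨h0, h1⟩, -, h⟩ := hP
  simp only [splitSource] at *
  rcases h with ⟨i, hi, rfl⟩ | rfl | ⟨i, hi, -, rfl⟩
  · have : (i : ℝ) < 2 * j + 1 := by exact_mod_cast hi
    exact ⟨i, (min_eq_left (this.le.trans (le_max_left _ _))).symm⟩
  · refine ⟨2 * j + 1, ?_⟩
    rw [max_eq_left (by linarith), min_eq_right (by linarith)]
    push_cast
    rfl
  · have : 2 * (j : ℝ) + 1 < i := by exact_mod_cast hi
    refine ⟨i, ?_⟩
    rw [max_eq_right (by linarith), min_eq_right (by linarith)]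
    ring

open Classical in
theorem exists_continuousOn_splitTangle (σ : CrossingRule) {n j : ℕ} {t b : ℕ → Bool}
    (h : SplitRel j t b) : ∃ F : ℝ × ℝ × ℝ → Bool, ContinuousOn F (splitTangle σ n j) ∧
      (∀ i < 2 * n, F ((i : ℝ), 1, 0) = t i) ∧ ∀ i < 2 * (n + 1), F ((i : ℝ), 0, 0) = b i := by
  obtain ⟨h1, h2, h3, h4⟩ := h
  refine ⟨fun P => if P ∈ splitArc σ j then b (2 * j + 1) else t ⌊splitSource j P⌋₊, ?_,
    fun i hi => ?_, fun i hi => ?_⟩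
  · rw [splitTangle_eq]
    refine ContinuousOn.union_of_isClosed ?_ ?_ (isClosed_splitStrands n j) (isClosed_splitArc σ j)
    · refine ((continuousOn_comp_floor t).comp (f := splitSource j) (s := splitStrands n j)
        (by unfold splitSource; fun_prop) fun P hP => splitSource_mem_range hP).congr fun P hP => ?_
      simp [splitArc_disjoint hP]
    · exact (continuousOn_const (c := b (2 * j + 1))).congr fun P hP => if_pos hP
  · have : ((i : ℝ), (1 : ℝ), (0 : ℝ)) ∉ splitArc σ j := by
      rintro ⟨-, h, -⟩
      norm_num at h
    simp [this, splitSource]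
  · by_cases hP : ((i : ℝ), (0 : ℝ), (0 : ℝ)) ∈ splitArc σ j
    · simp only [if_pos hP]
      rcases bottom_of_splitArc hP (.inl rfl) with h | h <;>
        obtain rfl := Nat.cast_injective (Prod.ext_iff.1 h).1
      · rfl
      · exact h3
    · have n1 : i ≠ 2 * j + 1 := by
        rintro rfl
        refine hP ⟨by simp, by norm_num, ?_, by simp⟩
        push_cast
        rw [show 2 * (j : ℝ) + 1 - (2 * j + 2) = -1 by ring]
        simp
      have n2 : i ≠ 2 * j + 3 := by
        rintro rfl
        refine hP ⟨by simp, by norm_num, ?_, by simp⟩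
        push_cast
        rw [show 2 * (j : ℝ) + 3 - (2 * j + 2) = 1 by ring]
        simp
      simp only [if_neg hP, splitSource]
      have key : min (i : ℝ) (max (2 * j + 1) (i - 2 * (1 - 0))) =
          ((min i (max (2 * j + 1) (i - 2)) : ℕ) : ℝ) := by
        rcases Nat.lt_or_ge i 2 with hi2 | hi2
        · have : (i : ℝ) ≤ 1 := by exact_mod_cast (by omega : i ≤ 1)
          rw [show min i (max (2 * j + 1) (i - 2)) = i by omega, min_eq_left]
          refine le_trans ?_ (le_max_left _ _)
          have : (0 : ℝ) ≤ j := by positivity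
          linarith
        · push_cast [Nat.cast_sub hi2]
          norm_num
      rw [key, Nat.floor_natCast]
      rcases lt_trichotomy i (2 * j + 2) with hlt | rfl | hlt
      · rw [min_eq_left (by omega), h1 i (by omega)]
      · rw [show min (2 * j + 2) (max (2 * j + 1) (2 * j + 2 - 2)) = 2 * j + 1 by omega, h2]
      · rw [show min i (max (2 * j + 1) (i - 2)) = i - 2 by omega, ← h4 _ (by omega)]
        congr 1
        omega

theorem mem_height_of_mem_vertexTangle {σ : CrossingRule} {n : ℕ} {v : Vertex} {P : ℝ × ℝ × ℝ}
    (hP : P ∈ vertexTangle σ n v) : P.2.1 ∈ Set.Icc (0 : ℝ) 1 := by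
  obtain ⟨k, j⟩ := v
  cases k with
  | split => exact hP.1
  | merge =>
    have h := hP.1
    simp only [Set.mem_Icc] at h ⊢
    constructor <;> linarith [h.1, h.2]

theorem isClosed_tangleReflect {S : Set (ℝ × ℝ × ℝ)} (hS : IsClosed S) :
    IsClosed (tangleReflect S) :=
  hS.preimage (f := fun P : ℝ × ℝ × ℝ => (P.1, 1 - P.2.1, P.2.2)) (by fun_prop)

theorem isClosed_vertexTangle (σ : CrossingRule) (n : ℕ) (v : Vertex) :
    IsClosed (vertexTangle σ n v) := by
  obtain ⟨k, j⟩ := v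
  cases k with
  | split => exact isClosed_splitTangle σ n j
  | merge => exact isClosed_tangleReflect (isClosed_splitTangle σ (n - 1) j)

theorem bottom_of_vertexTangle {σ : CrossingRule} {n : ℕ} {v : Vertex}
    (hv : v.pos + v.kind.ins ≤ n) {P : ℝ × ℝ × ℝ} (hP : P ∈ vertexTangle σ n v)
    (h0 : P.2.1 = 0) : ∃ i < 2 * (n - v.kind.ins + v.kind.outs), P = ((i : ℝ), 0, 0) := by
  obtain ⟨k, j⟩ := v
  obtain ⟨x, y, z⟩ := P
  simp only at h0
  subst h0
  cases k with
  | split =>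
    simp only [Kind.ins, Kind.outs] at hv ⊢
    change _ ∈ splitTangle σ n j at hP
    rw [splitTangle_eq] at hP
    rcases hP with ⟨-, hz, h⟩ | h
    · simp only at hz h
      subst hz
      rcases h with ⟨i, hi, rfl⟩ | rfl | ⟨i, hi, hi', rfl⟩
      · exact ⟨i, by omega, rfl⟩
      · exact ⟨2 * j + 2, by omega, by congr 1; push_cast; ring⟩
      · exact ⟨i + 2, by omega, by congr 1; push_cast; ring⟩
    · rcases bottom_of_splitArc h (.inr rfl) with h | h
      · exact ⟨_, by omega, h⟩
      · exact ⟨_, by omega, h⟩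
  | merge =>
    simp only [Kind.ins, Kind.outs] at hv ⊢
    change (x, 1 - (0 : ℝ), z) ∈ splitTangle σ (n - 1) j at hP
    rw [splitTangle_eq] at hP
    rcases hP with ⟨-, hz, h⟩ | ⟨-, h, -⟩
    · simp only at hz h
      subst hz
      rcases h with ⟨i, hi, rfl⟩ | rfl | ⟨i, hi, hi', rfl⟩
      · exact ⟨i, by omega, rfl⟩
      · exact ⟨2 * j + 1, by omega, by congr 1; push_cast; ring⟩
      · exact ⟨i, by omega, by congr 1; ring⟩
    · norm_num at h

theorem vertexRel_of_continuousOn {σ : CrossingRule} {n : ℕ} {v : Vertex}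
    (hv : v.pos + v.kind.ins ≤ n) {F : ℝ × ℝ × ℝ → Bool}
    (hF : ContinuousOn F (vertexTangle σ n v)) (τ : ℕ → Bool) :
    VertexRel v (endColours F (2 * n) 1 τ)
      (endColours F (2 * (n - v.kind.ins + v.kind.outs)) 0 τ) := by
  obtain ⟨k, j⟩ := v
  cases k with
  | split =>
    simp only [Kind.ins, Kind.outs] at hv ⊢
    have := splitRel_of_continuousOn (by omega) hF τ
    rwa [show 2 * (n - 1 + 2) = 2 * (n + 1) by omega]
  | merge =>
    simp only [Kind.ins, Kind.outs] at hv ⊢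
    have h1 : ContinuousOn (fun P : ℝ × ℝ × ℝ => F (P.1, 1 - P.2.1, P.2.2))
        (splitTangle σ (n - 1) j) :=
      hF.comp (f := fun P : ℝ × ℝ × ℝ => (P.1, 1 - P.2.1, P.2.2)) (by fun_prop) fun P hP => by
        change (P.1, 1 - (1 - P.2.1), P.2.2) ∈ splitTangle σ (n - 1) j
        rwa [sub_sub_cancel]
    have := splitRel_of_continuousOn (by omega) h1 τ
    change SplitRel _ _ _
    convert this using 1 <;> funext i <;> simp only [endColours]
    · rw [show n - 2 + 1 = n - 1 by omega, sub_self]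
    · rw [show n - 1 + 1 = n by omega, sub_zero]

theorem exists_continuousOn_vertexTangle (σ : CrossingRule) {n : ℕ} {v : Vertex}
    (hv : v.pos + v.kind.ins ≤ n) {t b : ℕ → Bool} (h : VertexRel v t b) :
    ∃ F : ℝ × ℝ × ℝ → Bool, ContinuousOn F (vertexTangle σ n v) ∧
      (∀ i < 2 * n, F ((i : ℝ), 1, 0) = t i) ∧
      ∀ i < 2 * (n - v.kind.ins + v.kind.outs), F ((i : ℝ), 0, 0) = b i := by
  obtain ⟨k, j⟩ := v
  cases k with
  | split =>
    simp only [Kind.ins, Kind.outs] at hv ⊢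
    obtain ⟨F, h1, h2, h3⟩ := exists_continuousOn_splitTangle σ (n := n) h
    exact ⟨F, h1, h2, fun i hi => h3 i (by omega)⟩
  | merge =>
    simp only [Kind.ins, Kind.outs] at hv ⊢
    obtain ⟨F, h1, h2, h3⟩ := exists_continuousOn_splitTangle σ (n := n - 1) h
    refine ⟨fun P => F (P.1, 1 - P.2.1, P.2.2), ?_, fun i hi => ?_, fun i hi => ?_⟩
    · exact h1.comp (f := fun P : ℝ × ℝ × ℝ => (P.1, 1 - P.2.1, P.2.2)) (by fun_prop)
        fun P hP => hP
    · simp only [sub_self]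
      exact h3 i (by omega)
    · simp only [sub_zero]
      exact h2 i (by omega)

theorem mem_height_of_mem_wordTangle {σ : CrossingRule} {n : ℕ} {w : List Vertex}
    {P : ℝ × ℝ × ℝ} (hP : P ∈ wordTangle σ n w) : P.2.1 ∈ Set.Icc (0 : ℝ) 1 := by
  induction w generalizing n P with
  | nil => exact hP.1
  | cons v w ih =>
    rcases hP with ⟨h1, h2⟩ | ⟨h1, h2⟩
    · have := (mem_height_of_mem_vertexTangle h2).2
      simp only at this
      constructor <;> linarith
    · have := (ih h2).1
      simp only at this
      constructor <;> linarith

theorem isClosed_wordTangle (σ : CrossingRule) (n : ℕ) (w : List Vertex) :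
    IsClosed (wordTangle σ n w) := by
  induction w generalizing n with
  | nil =>
    exact isClosed_height.and <| (isClosed_eq (by fun_prop) (by fun_prop)).and <|
      isClosed_exists_lt _ fun i => isClosed_eq (by fun_prop) (by fun_prop)
  | cons v w ih =>
    refine isClosed_or ?_ ?_
    · exact (isClosed_le (by fun_prop) (by fun_prop)).and <|
        (isClosed_vertexTangle σ n v).preimage
          (f := fun P : ℝ × ℝ × ℝ => (P.1, 2 * P.2.1 - 1, P.2.2)) (by fun_prop)
    · exact (isClosed_le (by fun_prop) (by fun_prop)).and <|
        (ih _).preimage (f := fun P : ℝ × ℝ × ℝ => (P.1, 2 * P.2.1, P.2.2)) (by fun_prop)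

/-- The values of a continuous two-colouring of a tangle at the endpoints are a colouring in the
combinatorial sense. -/
theorem wordRel_of_continuousOn {σ : CrossingRule} {n n' : ℕ} {w : List Vertex}
    (hw : Fits n w n') {F : ℝ × ℝ × ℝ → Bool} (hF : ContinuousOn F (wordTangle σ n w))
    (τ : ℕ → Bool) : WordRel w (endColours F (2 * n) 1 τ) (endColours F (2 * n') 0 τ) := by
  induction w generalizing n F with
  | nil =>
    obtain rfl : n = n' := hw
    funext i
    simp only [endColours]
    split_ifs with hi
    · exact (ContinuousOn.eq_of_path hF (γ := fun y => ((i : ℝ), y, 0)) (by fun_prop) zero_le_one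
        fun y hy => ⟨hy, rfl, i, hi, rfl⟩).symm
    · rfl
  | cons v w ih =>
    have h1 : ContinuousOn (fun P : ℝ × ℝ × ℝ => F (P.1, (1 + P.2.1) / 2, P.2.2))
        (vertexTangle σ n v) :=
      hF.comp (f := fun P : ℝ × ℝ × ℝ => (P.1, (1 + P.2.1) / 2, P.2.2)) (by fun_prop)
        fun P hP => by
          have := (mem_height_of_mem_vertexTangle hP).1
          refine .inl ⟨by simp only; linarith, ?_⟩
          simp only
          rwa [mul_div_cancel₀ _ (two_ne_zero' ℝ), add_sub_cancel_left]
    have h2 : ContinuousOn (fun P : ℝ × ℝ × ℝ => F (P.1, P.2.1 / 2, P.2.2))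
        (wordTangle σ (n - v.kind.ins + v.kind.outs) w) :=
      hF.comp (f := fun P : ℝ × ℝ × ℝ => (P.1, P.2.1 / 2, P.2.2)) (by fun_prop) fun P hP => by
        have := (mem_height_of_mem_wordTangle hP).2
        refine .inr ⟨by simp only; linarith, ?_⟩
        simp only
        rwa [mul_div_cancel₀ _ (two_ne_zero' ℝ)]
    refine ⟨endColours F (2 * (n - v.kind.ins + v.kind.outs)) (1 / 2) τ, ?_, ?_⟩
    · convert vertexRel_of_continuousOn hw.1 h1 τ using 1 <;> funext i <;>
        simp only [endColours] <;> norm_num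
    · convert ih hw.2 h2 using 1 <;> funext i <;> simp only [endColours]
      norm_num

open Classical in
/-- Every colouring of a tangle in the combinatorial sense comes from a continuous one. -/
theorem exists_continuousOn_wordTangle (σ : CrossingRule) {n n' : ℕ} {w : List Vertex}
    (hw : Fits n w n') {t b : ℕ → Bool} (h : WordRel w t b) :
    ∃ F : ℝ × ℝ × ℝ → Bool, ContinuousOn F (wordTangle σ n w) ∧
      (∀ i < 2 * n, F ((i : ℝ), 1, 0) = t i) ∧ ∀ i < 2 * n', F ((i : ℝ), 0, 0) = b i := by
  induction w generalizing n t with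
  | nil =>
    obtain rfl : n = n' := hw
    obtain rfl : t = b := h
    refine ⟨fun P => t ⌊P.1⌋₊, ?_, by simp, by simp⟩
    refine (continuousOn_comp_floor t).comp (f := Prod.fst) (by fun_prop) ?_
    rintro P ⟨-, -, i, -, hi⟩
    exact ⟨i, hi.symm⟩
  | cons v w ih =>
    obtain ⟨c, hc, hcb⟩ := h
    obtain ⟨F₁, f1, f2, f3⟩ := exists_continuousOn_vertexTangle σ hw.1 hc
    obtain ⟨F₂, g1, g2, g3⟩ := ih hw.2 hcb
    set A : Set (ℝ × ℝ × ℝ) :=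
      {P | 1 / 2 ≤ P.2.1 ∧ (P.1, 2 * P.2.1 - 1, P.2.2) ∈ vertexTangle σ n v} with hA
    set B : Set (ℝ × ℝ × ℝ) := {P | P.2.1 ≤ 1 / 2 ∧
      (P.1, 2 * P.2.1, P.2.2) ∈ wordTangle σ (n - v.kind.ins + v.kind.outs) w} with hB
    have hAB : wordTangle σ n (v :: w) = A ∪ B := rfl
    have cA : IsClosed A := (isClosed_le (by fun_prop) (by fun_prop)).and <|
      (isClosed_vertexTangle σ n v).preimage
        (f := fun P : ℝ × ℝ × ℝ => (P.1, 2 * P.2.1 - 1, P.2.2)) (by fun_prop)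
    have cB : IsClosed B := (isClosed_le (by fun_prop) (by fun_prop)).and <|
      (isClosed_wordTangle σ _ w).preimage
        (f := fun P : ℝ × ℝ × ℝ => (P.1, 2 * P.2.1, P.2.2)) (by fun_prop)
    refine ⟨fun P => if P ∈ A ∨ 1 / 2 < P.2.1 then F₁ (P.1, 2 * P.2.1 - 1, P.2.2)
      else F₂ (P.1, 2 * P.2.1, P.2.2), ?_, fun i hi => ?_, fun i hi => ?_⟩
    · rw [hAB]
      refine ContinuousOn.union_of_isClosed ?_ ?_ cA cB
      · refine (f1.comp (f := fun P : ℝ × ℝ × ℝ => (P.1, 2 * P.2.1 - 1, P.2.2)) (s := A)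
          (by fun_prop) fun P hP => hP.2).congr fun P hP => ?_
        simp [hP]
      · refine (g1.comp (f := fun P : ℝ × ℝ × ℝ => (P.1, 2 * P.2.1, P.2.2)) (s := B)
          (by fun_prop) fun P hP => hP.2).congr fun P hP => ?_
        by_cases hPA : P ∈ A
        · obtain ⟨x, y, z⟩ := P
          have e1 := hP.1
          have e2 := hPA.1
          simp only at e1 e2
          obtain rfl : y = 1 / 2 := le_antisymm e1 e2
          obtain ⟨i, hi, hPi⟩ := bottom_of_vertexTangle hw.1 hPA.2 (by norm_num)
          simp only [Prod.mk.injEq] at hPi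
          obtain ⟨rfl, -, rfl⟩ := hPi
          simp only [hPA, true_or, if_true, Function.comp_apply]
          norm_num
          rw [f3 i hi, g2 i hi]
        · simp only [hPA, hP.1.not_gt, or_self, if_false, Function.comp_apply]
    · rw [← f2 i hi]
      norm_num
    · have hP : ¬(((i : ℝ), (0 : ℝ), (0 : ℝ)) ∈ A ∨ (1 / 2 : ℝ) < 0) := by
        rintro (⟨h, -⟩ | h) <;> norm_num at h
      simp only [if_neg hP, mul_zero]
      exact g3 i hi

theorem wordTangle_subset_slab (σ : CrossingRule) (n : ℕ) (w : List Vertex) :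
    wordTangle σ n w ⊆ {P | P.2.1 ∈ Set.Icc (0 : ℝ) 1} := fun _ => mem_height_of_mem_wordTangle

open Classical in
/-- Continuous two-colourings can be transported along homeomorphisms that fix the endpoints. -/
theorem exists_continuousOn_of_homeomorph {p q : ℕ} {S S' : Set (ℝ × ℝ × ℝ)}
    (hS : S ⊆ {P | P.2.1 ∈ Set.Icc (0 : ℝ) 1}) {f : Slab ≃ₜ Slab}
    (hf : ∀ P : Slab, (P : ℝ × ℝ × ℝ) ∈ tangleEndpoints p q → f P = P)
    (hSS : ∀ P : Slab, (P : ℝ × ℝ × ℝ) ∈ S → (f P : ℝ × ℝ × ℝ) ∈ S') {F : ℝ × ℝ × ℝ → Bool}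
    (hF : ContinuousOn F S') :
    ∃ F' : ℝ × ℝ × ℝ → Bool, ContinuousOn F' S ∧ ∀ P ∈ tangleEndpoints p q, F' P = F P := by
  refine ⟨fun P => if hP : P.2.1 ∈ Set.Icc (0 : ℝ) 1 then F (f ⟨P, hP⟩) else F P, ?_, ?_⟩
  · rw [continuousOn_iff_continuous_domRestrict] at hF ⊢
    have : Continuous fun P : S => (⟨(f ⟨P, hS P.2⟩ : ℝ × ℝ × ℝ), hSS ⟨P, hS P.2⟩ P.2⟩ : S') := by
      fun_prop
    refine (hF.comp this).congr fun P => ?_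
    have hP : (P : ℝ × ℝ × ℝ).2.1 ∈ Set.Icc (0 : ℝ) 1 := hS P.2
    simp only [Function.comp_apply, Set.domRestrict_apply, dif_pos hP]
  · intro P hP
    have hP' : P.2.1 ∈ Set.Icc (0 : ℝ) 1 := by
      rcases hP with ⟨i, -, rfl⟩ | ⟨i, -, rfl⟩ <;> simp
    simp only [dif_pos hP', hf ⟨P, hP'⟩ hP]

/-- A homeomorphism of the slab that fixes the endpoints and maps the first tangle into the second
one turns the colourings of the second tangle into colourings of the first one. -/
theorem colours_of_homeomorph {σ : CrossingRule} {m n : ℕ} {w w' : List Vertex} (hw : Fits m w n)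
    (hw' : Fits m w' n) {f : Slab ≃ₜ Slab}
    (hf : ∀ P : Slab, (P : ℝ × ℝ × ℝ) ∈ tangleEndpoints (2 * m) (2 * n) → f P = P)
    (hSS : ∀ P : Slab, (P : ℝ × ℝ × ℝ) ∈ wordTangle σ m w →
      (f P : ℝ × ℝ × ℝ) ∈ wordTangle σ m w') :
    (∀ t, TopColours w' t → TopColours w t) ∧ ∀ b, BottomColours w' b → BottomColours w b := by
  have key : ∀ t b τ, WordRel w' t b → ∃ F : ℝ × ℝ × ℝ → Bool,
      WordRel w (endColours F (2 * m) 1 τ) (endColours F (2 * n) 0 τ) ∧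
      (∀ i < 2 * m, F ((i : ℝ), 1, 0) = t i) ∧ ∀ i < 2 * n, F ((i : ℝ), 0, 0) = b i := by
    intro t b τ h
    obtain ⟨F, h1, h2, h3⟩ := exists_continuousOn_wordTangle σ hw' h
    obtain ⟨F', h4, h5⟩ :=
      exists_continuousOn_of_homeomorph (wordTangle_subset_slab σ m w) hf hSS h1
    refine ⟨F', wordRel_of_continuousOn hw h4 τ, fun i hi => ?_, fun i hi => ?_⟩
    · rw [h5 _ (.inl ⟨i, hi, rfl⟩), h2 i hi]
    · rw [h5 _ (.inr ⟨i, hi, rfl⟩), h3 i hi]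
  have ext : ∀ (F : ℝ × ℝ × ℝ → Bool) (p : ℕ) (a : ℝ) (t : ℕ → Bool),
      (∀ i < p, F ((i : ℝ), a, 0) = t i) → endColours F p a (fun i => t (i + p)) = t := by
    intro F p a t h
    funext i
    simp only [endColours]
    split_ifs with hi
    · exact h i hi
    · rw [Nat.sub_add_cancel (by omega)]
  constructor
  · rintro t ⟨b, h⟩
    obtain ⟨F, h1, h2, -⟩ := key t b (fun i => t (i + 2 * m)) h
    rw [ext F _ _ t h2] at h1
    exact ⟨_, h1⟩
  · rintro b ⟨t, h⟩
    obtain ⟨F, h1, -, h2⟩ := key t b (fun i => b (i + 2 * n)) h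
    rw [ext F _ _ b h2] at h1
    exact ⟨_, h1⟩

/-- The colourings of the endpoints are an invariant of tangles up to isotopy rel endpoints. -/
theorem TangleIsotopic.colours_iff {σ : CrossingRule} {m n : ℕ} {w w' : List Vertex}
    (hw : Fits m w n) (hw' : Fits m w' n)
    (h : TangleIsotopic (2 * m) (2 * n) (wordTangle σ m w) (wordTangle σ m w')) :
    (∀ t, TopColours w t ↔ TopColours w' t) ∧ ∀ b, BottomColours w b ↔ BottomColours w' b := by
  obtain ⟨H, -, -, h1, h2⟩ := h
  have h3 := colours_of_homeomorph hw hw' (h1 1) fun P hP => by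
    have : H 1 P ∈ (H 1) '' ((↑) ⁻¹' wordTangle σ m w) := ⟨P, hP, rfl⟩
    rw [h2] at this
    exact this
  have h4 := colours_of_homeomorph hw' hw (f := (H 1).symm)
    (fun P hP => by rw [Homeomorph.symm_apply_eq, h1 1 P hP]) fun P hP => by
      have : P ∈ (H 1) '' ((↑) ⁻¹' wordTangle σ m w) := by
        rw [h2]
        exact hP
      obtain ⟨Q, hQ, rfl⟩ := this
      rw [Homeomorph.symm_apply_apply]
      exact hQ
  exact ⟨fun t => ⟨h4.1 t, h3.1 t⟩, fun b => ⟨h4.2 b, h3.2 b⟩⟩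

/-! ### Strand diagrams as words -/

theorem fits_append_iff {w w' : List Vertex} {m n : ℕ} :
    Fits m (w ++ w') n ↔ ∃ k, Fits m w k ∧ Fits k w' n :=
  ⟨Fits.of_append, fun ⟨_, h, h'⟩ => h.append h'⟩

theorem fits_swap_iff (X : Vertex) (Y : Kind) (d : ℕ) (w : List Vertex) (m n : ℕ) :
    Fits m (X :: ⟨Y, X.pos + X.kind.outs + d⟩ :: w) n ↔
      Fits m (⟨Y, X.pos + X.kind.ins + d⟩ :: X :: w) n := by
  obtain ⟨X, p⟩ := X
  simp only [Fits, ← and_assoc]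
  have h : (p + X.ins ≤ m ∧ p + X.outs + d + Y.ins ≤ m - X.ins + X.outs) ↔
      (p + X.ins + d + Y.ins ≤ m ∧ p + X.ins ≤ m - Y.ins + Y.outs) := by
    cases X <;> cases Y <;> simp only [Kind.ins, Kind.outs] <;> omega
  rw [h]
  refine and_congr_right fun h' => ?_
  rw [show m - X.ins + X.outs - Y.ins + Y.outs = m - Y.ins + Y.outs - X.ins + X.outs by
    cases X <;> cases Y <;> simp only [Kind.ins, Kind.outs] at h' ⊢ <;> omega]

theorem WordIso.fits_iff {w w' : List Vertex} (h : WordIso w w') (m n : ℕ) :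
    Fits m w n ↔ Fits m w' n := by
  induction h with
  | rel _ _ h =>
    obtain ⟨a, b, X, Y, d, rfl, rfl⟩ := h
    simp only [fits_append_iff, fits_swap_iff]
  | refl => rfl
  | symm _ _ _ ih => exact ih.symm
  | trans _ _ _ _ _ h1 h2 => exact h1.trans h2

theorem WordIso.isotopic {w w' : List Vertex} (h : WordIso w w') {m n : ℕ} (hw : Fits m w n)
    (hw' : Fits m w' n) : StrandDiagram.Isotopic ⟨w, hw⟩ ⟨w', hw'⟩ := by
  induction h with
  | rel _ _ h => exact .rel _ _ h
  | refl => exact .refl _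
  | symm _ _ _ ih => exact (ih hw' hw).symm
  | trans _ _ _ h _ h1 h2 =>
    have h3 := (WordIso.fits_iff h m n).1 hw
    exact (h1 hw h3).trans _ _ _ (h2 h3 hw')

theorem StrandDiagram.Isotopic.wordIso {m n : ℕ} {Γ Γ' : StrandDiagram m n}
    (h : Γ.Isotopic Γ') : WordIso Γ.verts Γ'.verts := by
  induction h with
  | rel _ _ h => exact .rel _ _ h
  | refl => exact .refl _
  | symm _ _ _ ih => exact ih.symm
  | trans _ _ _ _ _ h1 h2 => exact h1.trans _ _ _ h2

theorem fits_of_cancel {a b : List Vertex} {j m n : ℕ} {K : Kind}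
    (h : Fits m (a ++ (⟨K, j⟩ :: ⟨K.flip, j⟩ :: b)) n) : Fits m (a ++ b) n := by
  rw [fits_append_iff] at h ⊢
  obtain ⟨k, h1, h2, h3, h4⟩ := h
  refine ⟨k, h1, ?_⟩
  convert h4 using 1
  cases K <;> simp only [Kind.ins, Kind.outs, Kind.flip] at h2 h3 ⊢ <;> omega

theorem StrandDiagram.IsReduced.wordReduced {m n : ℕ} {Γ : StrandDiagram m n}
    (h : Γ.IsReduced) : WordReduced Γ.verts := by
  intro a b j
  constructor
  · intro h'
    have h1 := (h'.fits_iff m n).1 Γ.fits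
    exact h ⟨a ++ b, fits_of_cancel (K := .split) h1⟩
      ⟨⟨_, h1⟩, h'.isotopic Γ.fits h1, a, b, j, .inl rfl, rfl⟩
  · intro h'
    have h1 := (h'.fits_iff m n).1 Γ.fits
    exact h ⟨a ++ b, fits_of_cancel (K := .merge) h1⟩
      ⟨⟨_, h1⟩, h'.isotopic Γ.fits h1, a, b, j, .inr rfl, rfl⟩

theorem Reduces.wordPerm_eq {m n : ℕ} {Γ Γ' : StrandDiagram m n} (h : Reduces Γ Γ') :
    wordPerm Γ'.verts = wordPerm Γ.verts := by
  obtain ⟨Γ₀, h1, a, b, j, h2, h3⟩ := h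
  rw [h1.wordIso.perm_eq, h3, wordPerm_append]
  rcases h2 with h2 | h2 <;> simp [h2, wordPerm_append, wordPerm, Vertex.perm, mul_assoc]

theorem StrandDiagram.reduce_isReduced {m n : ℕ} (Γ : StrandDiagram m n) : Γ.reduce.IsReduced :=
  (exists_reduction Γ).choose_spec.2

theorem StrandDiagram.wordPerm_reduce {m n : ℕ} (Γ : StrandDiagram m n) :
    wordPerm Γ.reduce.verts = wordPerm Γ.verts := by
  have key : ∀ Γ', Relation.ReflTransGen Reduces Γ Γ' → wordPerm Γ'.verts = wordPerm Γ.verts := by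
    intro Γ' h
    induction h with
    | refl => rfl
    | tail _ h ih => rw [h.wordPerm_eq, ih]
  exact key _ (exists_reduction Γ).choose_spec.1

/-- The bijection of the strand diagram `T₂* ∘ T₁` of an element of `F`: it acts on sequences of
binary digits by exchanging prefixes. -/
noncomputable def deltaPerm (g : ThompsonF) : Equiv.Perm (ℕ × Stream' Bool) :=
  (wordPerm (treeVerts (treePair g).2 0))⁻¹ * wordPerm (treeVerts (treePair g).1 0)

theorem wordPerm_Theta (k : ℕ) (g : ThompsonF) : wordPerm (Theta k g).verts =
    wordPerm (treeVerts (symTree k) 0) * deltaPerm g *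
      (wordPerm (treeVerts (symTree k) 0))⁻¹ := by
  have h : ∀ {n : ℕ} (Γ : StrandDiagram 1 n),
      wordPerm Γ.reflect.verts = (wordPerm Γ.verts)⁻¹ := fun Γ => wordPerm_reflectWord Γ.verts
  simp only [Theta, StrandDiagram.star, StrandDiagram.wordPerm_reduce, StrandDiagram.comp,
    wordPerm_append, h, delta, symDiagram, deltaPerm, treeDiagram]

/-! ### Trees and binary digits -/

/-- The leaves of a tree from left to right, as paths from the root: `false` stands for a step to
the left child, `true` for a step to the right child. -/
def leafPaths : PTree → List (List Bool)
  | .nil => [[]]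
  | .node _ l r => (leafPaths l).map (List.cons false) ++ (leafPaths r).map (List.cons true)

theorem length_leafPaths (T : PTree) : (leafPaths T).length = T.numLeaves := by
  induction T with
  | nil => simp [leafPaths]
  | node _ l r hl hr => simp [leafPaths, hl, hr]

theorem wordPerm_treeVerts_lt (T : PTree) {p i : ℕ} (h : i < p) (s : Stream' Bool) :
    wordPerm (treeVerts T p) (i, s) = (i, s) := by
  induction T generalizing p i s with
  | nil => rfl
  | node _ l r hl hr =>
    rw [treeVerts, wordPerm, wordPerm_append, Equiv.Perm.mul_apply, Equiv.Perm.mul_apply,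
      perm_split_lt h, hr (by omega), hl h]

theorem wordPerm_treeVerts_gt (T : PTree) {p i : ℕ} (h : p < i) (s : Stream' Bool) :
    wordPerm (treeVerts T p) (i, s) = (i - 1 + T.numLeaves, s) := by
  induction T generalizing p i s with
  | nil =>
    change (i, s) = _
    simp
    omega
  | node _ l r hl hr =>
    have := r.numLeaves_pos
    rw [treeVerts, wordPerm, wordPerm_append, Equiv.Perm.mul_apply, Equiv.Perm.mul_apply,
      perm_split_gt h, hr (by omega), hl (by omega), BinaryTree.numLeaves]
    congr 1
    omega

/-- The strand diagram of a tree sends the dyadic part that corresponds to the `i`-th leaf onto the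
`i`-th of the strands growing out of the tree. -/
theorem wordPerm_treeVerts {T : PTree} {p i : ℕ} {a : List Bool} (h : (leafPaths T)[i]? = some a)
    (s : Stream' Bool) : wordPerm (treeVerts T p) (p, a ++ₛ s) = (p + i, s) := by
  induction T generalizing p i a s with
  | nil =>
    obtain ⟨hi, rfl⟩ := List.getElem?_eq_some_iff.1 h
    simp only [leafPaths, List.length_singleton, Nat.lt_one_iff] at hi
    subst hi
    rfl
  | node _ l r hl hr =>
    rw [treeVerts, wordPerm, wordPerm_append, Equiv.Perm.mul_apply, Equiv.Perm.mul_apply]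
    rw [leafPaths, List.getElem?_append] at h
    split_ifs at h with hi
    · rw [List.getElem?_map, Option.map_eq_some_iff] at h
      obtain ⟨b, hb, rfl⟩ := h
      rw [Stream'.cons_append_stream, perm_split_false, wordPerm_treeVerts_lt r (by omega), hl hb]
    · rw [List.getElem?_map, Option.map_eq_some_iff] at h
      obtain ⟨b, hb, rfl⟩ := h
      rw [List.length_map, length_leafPaths] at hi hb
      have := l.numLeaves_pos
      rw [Stream'.cons_append_stream, perm_split_true, hr hb, wordPerm_treeVerts_gt l (by omega)]
      congr 1
      omega

theorem inv_wordPerm_treeVerts {T : PTree} {p i : ℕ} {a : List Bool}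
    (h : (leafPaths T)[i]? = some a) (s : Stream' Bool) :
    (wordPerm (treeVerts T p))⁻¹ (p + i, s) = (p, a ++ₛ s) := by
  rw [Equiv.Perm.inv_eq_iff_eq, wordPerm_treeVerts h]

theorem exists_leafPath {T : PTree} {x : List Bool} (h : T.height ≤ x.length) :
    ∃ (i : ℕ) (a y : List Bool), (leafPaths T)[i]? = some a ∧ x = a ++ y := by
  induction T generalizing x with
  | nil => exact ⟨0, [], x, rfl, rfl⟩
  | node _ l r hl hr =>
    cases x with
    | nil => simp at h
    | cons b x =>
      simp only [BinaryTree.height, List.length_cons, add_le_add_iff_right, max_le_iff] at h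
      cases b with
      | false =>
        obtain ⟨i, a, y, h1, rfl⟩ := hl h.1
        have hi := (List.getElem?_eq_some_iff.1 h1).1
        exact ⟨i, false :: a, y, by
          rw [leafPaths, List.getElem?_append_left (by simpa using hi), List.getElem?_map, h1]
          rfl, rfl⟩
      | true =>
        obtain ⟨i, a, y, h1, rfl⟩ := hr h.2
        exact ⟨(leafPaths l).length + i, true :: a, y,
          by simp [leafPaths, List.getElem?_append, h1], rfl⟩

theorem length_of_leafPath_symTree {k i : ℕ} {a : List Bool}
    (h : (leafPaths (symTree k))[i]? = some a) : a.length = k := by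
  have key : ∀ k, ∀ a ∈ leafPaths (symTree k), a.length = k := by
    intro k
    induction k with
    | zero => simp [symTree, leafPaths]
    | succ k ih =>
      intro a ha
      simp only [symTree, leafPaths, List.mem_append, List.mem_map] at ha
      rcases ha with ⟨b, hb, rfl⟩ | ⟨b, hb, rfl⟩ <;> simp [ih b hb]
  exact key k a (List.mem_of_getElem? h)

theorem height_symTree (k : ℕ) : (symTree k).height = k := by
  induction k with
  | zero => rfl
  | succ k ih => simp [symTree, ih]

/-- The strands of `Θ_k(g)` correspond to the standard dyadic intervals of length `2⁻ᵏ`. If `g` is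
affine on each of them, then its bijection contracts or expands every strand. -/
theorem contractsAt_or_expandsAt_Theta {k : ℕ} {g : ThompsonF}
    (hk : (treePair g).1.height ≤ k) (p : ℕ) :
    ContractsAt (wordPerm (Theta k g).verts) p ∨
      ∃ r, ExpandsAt (wordPerm (Theta k g).verts) p r := by
  have hlen := (treePair_spec g).1.numLeaves_eq
  simp only [wordPerm_Theta, deltaPerm, mul_assoc]
  have hS := numLeaves_symTree k
  have hpos : 0 < 2 ^ k := by positivity
  rcases Nat.lt_or_ge p (2 ^ k) with hp | hp
  · obtain ⟨a, ha⟩ : ∃ a, (leafPaths (symTree k))[p]? = some a :=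
      ⟨_, List.getElem?_eq_getElem (by rwa [length_leafPaths, hS])⟩
    have hak := length_of_leafPath_symTree ha
    obtain ⟨i, b, y, hb, rfl⟩ := exists_leafPath (hk.trans_eq hak.symm)
    obtain ⟨c, hc⟩ : ∃ c, (leafPaths (treePair g).2)[i]? = some c := by
      refine ⟨_, List.getElem?_eq_getElem ?_⟩
      have := (List.getElem?_eq_some_iff.1 hb).1
      rwa [length_leafPaths, ← hlen, ← length_leafPaths]
    have step : ∀ s : Stream' Bool, ((wordPerm (treeVerts (treePair g).2 0))⁻¹ *
        (wordPerm (treeVerts (treePair g).1 0) * (wordPerm (treeVerts (symTree k) 0))⁻¹)) (p, s) =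
          (0, (c ++ y) ++ₛ s) := by
      intro s
      have h1 := inv_wordPerm_treeVerts (p := 0) ha s
      have h2 := inv_wordPerm_treeVerts (p := 0) hc (y ++ₛ s)
      rw [zero_add] at h1 h2
      rw [Equiv.Perm.mul_apply, Equiv.Perm.mul_apply, h1, Stream'.append_append_stream,
        wordPerm_treeVerts hb, zero_add, h2, Stream'.append_append_stream]
    rcases Nat.lt_or_ge (c ++ y).length k with hlt | hge
    · refine .inr ⟨k - (c ++ y).length, fun u hu => ?_⟩
      obtain ⟨j, d, z, hd, hz⟩ := exists_leafPath (T := symTree k) (x := (c ++ y) ++ u)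
        (by rw [height_symTree, List.length_append]; omega)
      have hdk := length_of_leafPath_symTree hd
      have hz0 : z = [] := by
        have := congrArg List.length hz
        rw [List.length_append, List.length_append (as := d)] at this
        exact List.eq_nil_of_length_eq_zero (by omega)
      refine ⟨j, fun s => ?_⟩
      rw [Equiv.Perm.mul_apply, step, ← Stream'.append_append_stream, hz, hz0, List.append_nil,
        wordPerm_treeVerts hd, zero_add]
    · obtain ⟨j, d, z, hd, hz⟩ := exists_leafPath (T := symTree k) (x := c ++ y)
        (by rwa [height_symTree])
      refine .inl ⟨j, z, fun s => ?_⟩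
      rw [Equiv.Perm.mul_apply, step, hz, Stream'.append_append_stream, wordPerm_treeVerts hd,
        zero_add]
  · -- Strands beyond the last one of the diagram are unchanged.
    refine .inl ⟨p, [], fun s => ?_⟩
    have inv : ∀ (T : PTree) (i : ℕ), T.numLeaves ≤ i →
        (wordPerm (treeVerts T 0))⁻¹ (i, s) = (i + 1 - T.numLeaves, s) := by
      intro T i hi
      rw [Equiv.Perm.inv_eq_iff_eq, wordPerm_treeVerts_gt T (by omega)]
      congr 1
      omega
    simp only [Equiv.Perm.mul_apply]
    have hpos1 := (treePair g).1.numLeaves_pos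
    rw [inv (symTree k) _ (by omega), wordPerm_treeVerts_gt (treePair g).1 (by omega),
      inv (treePair g).2 _ (by omega), wordPerm_treeVerts_gt (symTree k) (by omega)]
    simp only [Stream'.nil_append_stream]
    congr 1
    omega

/-- The number in `[0, 1]` with the given binary digits. -/
noncomputable def digitValue (s : Stream' Bool) : ℝ :=
  Real.ofDigits (b := 2) fun n => if s.get n then 1 else 0

theorem digitValue_mem (s : Stream' Bool) : digitValue s ∈ unitInterval :=
  ⟨Real.ofDigits_nonneg _, Real.ofDigits_le_one _⟩

theorem exists_digitValue (x : unitInterval) : ∃ s, digitValue s = x := by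
  obtain ⟨d, -, hd⟩ := Real.ofDigits_SurjOn one_lt_two x.2
  refine ⟨fun n => decide (d n = 1), ?_⟩
  rw [← hd]
  change Real.ofDigits (b := 2) (fun n => if decide (d n = 1) then 1 else 0) = _
  congr 1
  funext n
  have : d n = 0 ∨ d n = 1 := by omega
  rcases this with h | h <;> simp [h]

theorem digitValue_cons (b : Bool) (s : Stream' Bool) :
    digitValue (Stream'.cons b s) = (b.toNat + digitValue s) / 2 := by
  rw [digitValue, Real.ofDigits_eq_sum_add_ofDigits _ 1]
  change _ + _ * digitValue s = _
  cases b <;> simp [Real.ofDigitsTerm, Stream'.get, Stream'.cons] <;> ring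

/-- The standard dyadic interval reached from a given one by a path in the infinite binary tree. -/
def descend : ℕ → ℕ → List Bool → ℕ × ℕ
  | c, n, [] => (c, n)
  | c, n, b :: a => descend (2 * c + b.toNat) (n + 1) a

theorem leafIntervals_eq_map (T : PTree) (c n : ℕ) :
    leafIntervals T c n = (leafPaths T).map (descend c n) := by
  induction T generalizing c n with
  | nil => rfl
  | node _ l r hl hr => simp [leafIntervals, leafPaths, hl, hr, Function.comp_def, descend]

theorem descend_value (a : List Bool) (c n : ℕ) (s : Stream' Bool) :
    ((c : ℝ) + digitValue (a ++ₛ s)) / 2 ^ n =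
      ((descend c n a).1 + digitValue s) / 2 ^ (descend c n a).2 := by
  induction a generalizing c n with
  | nil => rfl
  | cons b a ih =>
    rw [descend, ← ih, Stream'.cons_append_stream, digitValue_cons, pow_succ]
    push_cast
    field_simp
    ring

/-- On binary digits, an element of `F` is given by its prefix exchange. -/
theorem apply_digitValue (g : ThompsonF) (s : Stream' Bool) :
    (g.1 ⟨digitValue s, digitValue_mem s⟩ : ℝ) = digitValue (deltaPerm g (0, s)).2 := by
  set T₁ := (treePair g).1
  set T₂ := (treePair g).2
  obtain ⟨i, a, y, ha, hy⟩ := exists_leafPath (T := T₁) (x := s.take T₁.height) (by simp)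
  obtain ⟨s', rfl⟩ : ∃ s', s = a ++ₛ s' := ⟨y ++ₛ s.drop T₁.height, by
    rw [← Stream'.append_append_stream, ← hy, Stream'.append_take_drop]⟩
  have hR : Represents g.1 T₁ T₂ := (treePair_spec g).1
  have hlen := hR.numLeaves_eq
  obtain ⟨hi, ha'⟩ := List.getElem?_eq_some_iff.1 ha
  have hi2 : i < (leafPaths T₂).length := by rwa [length_leafPaths, ← hlen, ← length_leafPaths]
  obtain ⟨b, hb⟩ : ∃ b, (leafPaths T₂)[i]? = some b := ⟨_, List.getElem?_eq_getElem hi2⟩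
  obtain ⟨_, hb'⟩ := List.getElem?_eq_some_iff.1 hb
  have hM : MapsAffinely g.1 (descend 0 0 a) (descend 0 0 b) := by
    unfold Represents at hR
    rw [leafIntervals_eq_map, leafIntervals_eq_map, List.forall₂_iff_get] at hR
    have := hR.2 i (by simpa using hi) (by simpa using hi2)
    simpa [ha', hb'] using this
  have e1 := descend_value a 0 0 s'
  have e2 := descend_value b 0 0 s'
  have hs' := digitValue_mem s'
  simp only [Nat.cast_zero, zero_add, pow_zero, div_one] at e1 e2
  have hv : deltaPerm g (0, a ++ₛ s') = (0, b ++ₛ s') := by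
    have h1 := wordPerm_treeVerts (p := 0) ha s'
    have h2 := inv_wordPerm_treeVerts (p := 0) hb s'
    rw [deltaPerm, Equiv.Perm.mul_apply, h1, h2]
  rw [hv, e2]
  have := hM ⟨digitValue (a ++ₛ s'), digitValue_mem _⟩
    (by simp only [e1]; gcongr; linarith [hs'.1]) (by simp only [e1]; gcongr; exact hs'.2)
  simp only at this
  rw [eq_div_iff (by positivity)]
  have e3 : (2 : ℝ) ^ (descend 0 0 a).2 * digitValue (a ++ₛ s') =
      (descend 0 0 a).1 + digitValue s' := by
    rw [e1]
    field_simp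
  linarith

/-- An element of `F` is determined by its prefix exchange. -/
theorem deltaPerm_injective : Function.Injective deltaPerm := by
  intro g h hgh
  refine Subtype.ext (Homeomorph.ext fun x => Subtype.ext ?_)
  obtain ⟨s, hs⟩ := exists_digitValue x
  obtain rfl : x = ⟨digitValue s, digitValue_mem s⟩ := Subtype.ext hs.symm
  rw [apply_digitValue, apply_digitValue, hgh]

end Thompson

theorem mainTheorem2 (σ : Thompson.CrossingRule) (g h : Thompson.ThompsonF) (hgh : g ≠ h)
    (k : ℕ) (hk : max (Thompson.height g) (Thompson.height h) ≤ k)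
    (Γ Γ' : Thompson.StrandDiagram (2 ^ k) (2 ^ k))
    (hΓ : Γ.Isotopic (Thompson.Theta k g)) (hΓ' : Γ'.Isotopic (Thompson.Theta k h)) :
    ¬ Thompson.TangleIsotopic (2 ^ (k + 1)) (2 ^ (k + 1)) (Γ.tangle σ) (Γ'.tangle σ) := by
  intro hiso
  have hk' := max_le_iff.1 hk
  -- Both diagrams are isotopic to reduced ones with all merges above all splits.
  have sorted : ∀ (f : Thompson.ThompsonF) (Δ : Thompson.StrandDiagram (2 ^ k) (2 ^ k)),
      Thompson.height f ≤ k → Δ.Isotopic (Thompson.Theta k f) →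
      ∃ M P, Thompson.AllOf .merge M ∧ Thompson.AllOf .split P ∧
        Thompson.WordIso Δ.verts (M ++ P) := by
    intro f Δ hf hΔ
    have hred : Thompson.WordReduced (Thompson.Theta k f).verts :=
      (Thompson.StrandDiagram.reduce_isReduced _).wordReduced
    obtain ⟨M, P, hM, hP, hw⟩ := hred.exists_merges_append_splits
      (Thompson.contractsAt_or_expandsAt_Theta ((le_max_left _ _).trans hf))
    exact ⟨M, P, hM, hP, hΔ.wordIso.trans _ _ _ hw⟩
  obtain ⟨M, P, hM, hP, hw⟩ := sorted g Γ hk'.1 hΓ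
  obtain ⟨M', P', hM', hP', hw'⟩ := sorted h Γ' hk'.2 hΓ'
  rw [pow_succ'] at hiso
  obtain ⟨ht, hb⟩ := hiso.colours_iff Γ.fits Γ'.fits
  have key := Thompson.wordPerm_eq_of_colours hM hP hw hM' hP' hw' ht hb
  rw [hΓ.wordIso.perm_eq, hΓ'.wordIso.perm_eq, Thompson.wordPerm_Theta, Thompson.wordPerm_Theta,
    mul_left_inj, mul_right_inj] at key
  exact hgh (Thompson.deltaPerm_injective key)
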